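/- **Conventions.** Work over the field $\mathbb{Q}(A)$ of rational functions and put $\delta=-A^2-A^{-2}$. A $(k,l)$-tangle ($k$ end points on the top and $l$ on the bottom of a rectangle; closed components are allowed) is given by a diagram in the rectangle, and two tangles are *ambient isotopic* (with fixed end points) if their diagrams are related by planar isotopies and Reidemeister moves of types I, II and III. Let $\mathcal{S}(a,b)$ be the relative Kauffman bracket skein module over $\mathbb{Q}(A)$ of the disc with $a$ marked points on the top and $b$ on the bottom: the vector space spanned by isotopy classes of (blackboard) framed $(a,b)$-tangle diagrams modulo the Kauffman relations $L_\times = A\,L_{0}+A^{-1}L_{\infty}$ (the $A$-smoothing $L_0$ joins the two regions swept out by turning the over-strand counterclockwise) and $L\sqcup\bigcirc=\delta L$. Let $f^{(n)}\in\mathcal{S}(n,n)=TL_n$ be the Jones–Wenzl projector: $f^{(0)}=1$, $f^{(1)}=1$, and $f^{(m+2)}=g-\frac{\Delta_{m}}{\Delta_{m+1}}\,g\,e_{m+1}\,g$ with $g=f^{(m+1)}\otimes 1$, where $e_{m+1}$ is the diagram with a hook at the last two strands, $\Delta_0=1$, $\Delta_1=\delta$, $\Delta_{m+2}=\delta\Delta_{m+1}-\Delta_m$.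 The colored disc module $\mathcal{D}^k_l(n)\subseteq\mathcal{S}(nk,nl)$ is the space of all elements obtained from elements of $\mathcal{S}(nk,nl)$ by placing $f^{(n)}$ at each of the $k$ clusters of $n$ consecutive points on the top and each of the $l$ clusters of $n$ consecutive points on the bottom. For a diagram $T$ of a $(k,l)$-tangle, its $n$-th colored tangle $T^n\in\mathcal{D}^k_l(n)$ is obtained by replacing each strand by $n$ parallel strands (in the blackboard framing) and inserting $f^{(n)}$ on every component and at every end point. (Concretely, for a diagram cut into elementary horizontal slices, $f^{(n)}$ is inserted on each strand of each level between slices and at the top and the bottom; as $f^{(n)}$ is idempotent and slides along a component, the number of insertions does not matter.) **Theorem.** Let $k,l,n,s\ge 0$, and let $\{E_i\}_{i=0}^{s}$ be any basis of $\mathcal{D}^k_l(n)$ over $\mathbb{Q}(A)$. For a diagram $T$ of a $(k,l)$-tangle write $$T^n=\sum_{i=0}^{s}\gamma_i(T)\,E_i,\qquad \gamma_i(T)\in\mathbb{Q}(A).$$ Then, for $0\le i\le s-1$, the ratios $$CR^i_T(A)=\frac{\gamma_i(T)}{\gamma_s(T)}$$ are ambient isotopy invariants of $T$. That is, if $T$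 and $T'$ are diagrams of ambient isotopic $(k,l)$-tangles, then $\gamma_s(T)\neq 0$ if and only if $\gamma_s(T')\neq 0$, and in this case $\gamma_i(T)/\gamma_s(T)=\gamma_i(T')/\gamma_s(T')$ for all $0\le i\le s-1$. -/

import Mathlib

namespace TangleSkein

/-! ### Tangle diagrams

A tangle diagram in a rectangle is put in general position with respect to the height and read from
top to bottom, as a list of elementary slices.  The strands of a horizontal level are numbered
`0, 1, 2, …` from left to right. -/

/-- The elementary pieces: `cap` is a local maximum `∩` (it creates two adjacent strands), `cup` is a
local minimum `∪` (it joins two adjacent strands), `cross b` is a crossing of two adjacent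
strands.  In `cross true` the strand from top left to bottom right is the over-strand, in
`cross false` it is the under-strand. -/
inductive Elem where
  | cap : Elem
  | cup : Elem
  | cross (b : Bool) : Elem

/-- Number of end points of an elementary piece on its top side. -/
def Elem.top : Elem → ℕ
  | .cap => 0
  | .cup => 2
  | .cross _ => 2

/-- Number of end points of an elementary piece on its bottom side. -/
def Elem.bot : Elem → ℕ
  | .cap => 2
  | .cup => 0
  | .cross _ => 2

/-- A slice: an elementary piece with `pos` vertical strands on its left; on its right there are as
many vertical strands as the width of the level requires. -/
structure Slice where
  elem : Elem
  pos : ℕ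

abbrev cap (i : ℕ) : Slice := ⟨.cap, i⟩
abbrev cup (i : ℕ) : Slice := ⟨.cup, i⟩
abbrev cross (b : Bool) (i : ℕ) : Slice := ⟨.cross b, i⟩

/-- Add `a` vertical strands on the left of a slice. -/
def Slice.shift (a : ℕ) (s : Slice) : Slice := ⟨s.elem, a + s.pos⟩

/-- `IsDiag w k l`: the slices `w`, stacked from top to bottom, form a diagram with `k` end points on
the top and `l` end points on the bottom. -/
def IsDiag : List Slice → ℕ → ℕ → Prop
  | [], k, l => k = l
  | s :: w, k, l => s.pos + s.elem.top ≤ k ∧ IsDiag w (k - s.elem.top + s.elem.bot) l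

/-- Diagrams of `(k, l)`-tangles: `k` end points on the top, `l` end points on the bottom. -/
def Diag (k l : ℕ) : Type := {w : List Slice // IsDiag w k l}

theorem IsDiag.append {u v : List Slice} {k l m : ℕ} (hu : IsDiag u k l) (hv : IsDiag v l m) :
    IsDiag (u ++ v) k m := by
  induction u generalizing k with
  | nil => simp only [IsDiag] at hu; subst hu; simpa using hv
  | cons s u ih => exact ⟨hu.1, ih hu.2⟩

theorem IsDiag.addRight {w : List Slice} {k l : ℕ} (r : ℕ) (h : IsDiag w k l) :
    IsDiag w (k + r) (l + r) := by
  induction w generalizing k with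
  | nil => simp only [IsDiag] at h ⊢; omega
  | cons s w ih =>
    obtain ⟨h1, h2⟩ := h
    refine ⟨by omega, ?_⟩
    have := ih h2
    rwa [show k - s.elem.top + s.elem.bot + r = k + r - s.elem.top + s.elem.bot by omega] at this

theorem IsDiag.addLeft {w : List Slice} {k l : ℕ} (a : ℕ) (h : IsDiag w k l) :
    IsDiag (w.map (Slice.shift a)) (a + k) (a + l) := by
  induction w generalizing k with
  | nil => simp only [IsDiag, List.map_nil] at h ⊢; omega
  | cons s w ih =>
    obtain ⟨h1, h2⟩ := h
    refine ⟨by simp only [Slice.shift]; omega, ?_⟩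
    have := ih h2
    simp only [Slice.shift]
    rwa [show a + (k - s.elem.top + s.elem.bot) = a + k - s.elem.top + s.elem.bot by omega] at this

/-- The diagram made of `k` vertical strands. -/
def Diag.id (k : ℕ) : Diag k k := ⟨[], rfl⟩

/-- Vertical juxtaposition, the first diagram on top of the second one. -/
def Diag.comp {k l m : ℕ} (d : Diag k l) (d' : Diag l m) : Diag k m :=
  ⟨d.1 ++ d'.1, d.2.append d'.2⟩

/-- Add `r` vertical strands on the right. -/
def Diag.addRight {k l : ℕ} (r : ℕ) (d : Diag k l) : Diag (k + r) (l + r) := ⟨d.1, d.2.addRight r⟩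

/-- Add `a` vertical strands on the left. -/
def Diag.addLeft {k l : ℕ} (a : ℕ) (d : Diag k l) : Diag (a + k) (a + l) :=
  ⟨d.1.map (Slice.shift a), d.2.addLeft a⟩

/-! ### Isotopy -/

/-- Local moves between sliced diagrams that realize regular isotopy: planar isotopy (`far`,
`zigzag`, `slide`) and the Reidemeister moves of types II and III. -/
inductive RegularMove : List Slice → List Slice → Prop
  /-- Two pieces with disjoint supports exchange their heights. -/
  | far (e e' : Elem) (i d : ℕ) :
      RegularMove [⟨e, i⟩, ⟨e', i + e.bot + d⟩] [⟨e', i + e.top + d⟩, ⟨e, i⟩]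
  /-- Cancel a maximum against a neighbouring minimum on the same strand. -/
  | zigzag_right (i : ℕ) : RegularMove [cap (i + 1), cup i] []
  | zigzag_left (i : ℕ) : RegularMove [cap i, cup (i + 1)] []
  /-- A strand that crosses one leg of an extremum slides over it to the other leg. -/
  | slide_cap (b : Bool) (i : ℕ) :
      RegularMove [cap (i + 1), cross b i] [cap i, cross (!b) (i + 1)]
  | slide_cup (b : Bool) (i : ℕ) :
      RegularMove [cross b i, cup (i + 1)] [cross (!b) (i + 1), cup i]
  | reidemeister_two (b : Bool) (i : ℕ) : RegularMove [cross b i, cross (!b) i] []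
  | reidemeister_three (b : Bool) (i : ℕ) :
      RegularMove [cross b i, cross b (i + 1), cross b i]
        [cross b (i + 1), cross b i, cross b (i + 1)]

/-- A strand with a curl on its right side. -/
def curlRight (b : Bool) (i : ℕ) : List Slice := [cap (i + 1), cross b i, cup (i + 1)]

/-- A strand with a curl on its left side. -/
def curlLeft (b : Bool) (i : ℕ) : List Slice := [cap i, cross b (i + 1), cup i]

/-- Moves for framed tangles (blackboard framing): regular isotopy, and the exchange of two curls of
the same writhe. -/
inductive FramedMove : List Slice → List Slice → Prop
  | regular {u v : List Slice} : RegularMove u v → FramedMove u v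
  | curl (b : Bool) (i : ℕ) : FramedMove (curlRight b i) (curlLeft b i)

/-- Moves for (unframed) tangles: regular isotopy, and the Reidemeister move of type I. -/
inductive AmbientMove : List Slice → List Slice → Prop
  | regular {u v : List Slice} : RegularMove u v → AmbientMove u v
  | reidemeister_one_right (b : Bool) (i : ℕ) : AmbientMove (curlRight b i) []
  | reidemeister_one_left (b : Bool) (i : ℕ) : AmbientMove (curlLeft b i) []

/-- `d'` arises from `d` by applying one move of the list `M` inside the diagram. -/
def Step (M : List Slice → List Slice → Prop) {k l : ℕ} (d d' : Diag k l) : Prop :=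
  ∃ p u v q : List Slice, M u v ∧ d.1 = p ++ u ++ q ∧ d'.1 = p ++ v ++ q

/-- Ambient isotopy of tangles (with fixed end points), on diagrams: the equivalence relation
generated by planar isotopy and the three Reidemeister moves. -/
def AmbientIsotopic {k l : ℕ} : Diag k l → Diag k l → Prop :=
  Relation.EqvGen (Step AmbientMove)

/-! ### The Kauffman bracket skein module of the disc -/

/-- The field `ℚ(A)`. -/
abbrev K : Type := RatFunc ℚ

/-- The indeterminate `A`. -/
noncomputable def A : K := RatFunc.X

/-- The value of a circle, `δ = - A² - A⁻²`. -/
noncomputable def loopValue : K := -A ^ 2 - A⁻¹ ^ 2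

/-- Formal linear combinations of diagrams. -/
abbrev Formal (k l : ℕ) : Type := Diag k l →₀ K

noncomputable def Formal.of {k l : ℕ} (d : Diag k l) : Formal k l := Finsupp.single d 1

/-- The defining relations of the skein module: isotopy of framed tangles, the Kauffman relation at a
crossing and the removal of a circle that bounds a disc.  The smoothing with coefficient `A` is
the one that joins the two regions swept out by turning the over-strand counterclockwise. -/
inductive SkeinRel {k l : ℕ} : Formal k l → Prop
  | isotopy (d d' : Diag k l) : Step FramedMove d d' → SkeinRel (Formal.of d - Formal.of d')
  | cross_true (d dh dv : Diag k l) (p q : List Slice) (i : ℕ) :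
      d.1 = p ++ [cross true i] ++ q → dh.1 = p ++ [cup i, cap i] ++ q → dv.1 = p ++ [] ++ q →
      SkeinRel (Formal.of d - A • Formal.of dh - A⁻¹ • Formal.of dv)
  | cross_false (d dh dv : Diag k l) (p q : List Slice) (i : ℕ) :
      d.1 = p ++ [cross false i] ++ q → dh.1 = p ++ [cup i, cap i] ++ q → dv.1 = p ++ [] ++ q →
      SkeinRel (Formal.of d - A • Formal.of dv - A⁻¹ • Formal.of dh)
  | circle (d d' : Diag k l) (p q : List Slice) (i : ℕ) :
      d.1 = p ++ [cap i, cup i] ++ q → d'.1 = p ++ [] ++ q →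
      SkeinRel (Formal.of d - loopValue • Formal.of d')

/-- The submodule generated by the defining relations. -/
noncomputable def skeinRelations (k l : ℕ) : Submodule K (Formal k l) :=
  Submodule.span K {x | SkeinRel x}

/-- The relative Kauffman bracket skein module, over `ℚ(A)`, of the disc with `k` marked points on the
top and `l` marked points on the bottom. -/
abbrev Skein (k l : ℕ) : Type := Formal k l ⧸ skeinRelations k l

/-- The class of a diagram in the skein module. -/
noncomputable def Skein.of {k l : ℕ} (d : Diag k l) : Skein k l :=
  (skeinRelations k l).mkQ (Formal.of d)

theorem FramedMove.shift {u v : List Slice} (a : ℕ) (h : FramedMove u v) :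
    FramedMove (u.map (Slice.shift a)) (v.map (Slice.shift a)) := by
  cases h with
  | regular h =>
    apply FramedMove.regular
    cases h with
    | far e e' i d =>
      have := RegularMove.far e e' (a + i) d
      simpa [Slice.shift, Nat.add_assoc] using this
    | zigzag_right i => exact RegularMove.zigzag_right (a + i)
    | zigzag_left i => exact RegularMove.zigzag_left (a + i)
    | slide_cap b i => exact RegularMove.slide_cap b (a + i)
    | slide_cup b i => exact RegularMove.slide_cup b (a + i)
    | reidemeister_two b i => exact RegularMove.reidemeister_two b (a + i)
    | reidemeister_three b i => exact RegularMove.reidemeister_three b (a + i)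
  | curl b i => exact FramedMove.curl b (a + i)

/-- The operation on diagrams that adds strands on the left and stacks fixed diagrams above and
below respects the defining relations of the skein module. -/
theorem SkeinRel.map {k l k' l' : ℕ} (a : ℕ) (p₀ q₀ : List Slice) (φ : Diag k l → Diag k' l')
    (hφ : ∀ d, (φ d).1 = p₀ ++ d.1.map (Slice.shift a) ++ q₀) {x : Formal k l} (hx : SkeinRel x) :
    Finsupp.mapDomain φ x ∈ skeinRelations k' l' := by
  have hof : ∀ d, Finsupp.mapDomain φ (Formal.of d) = Formal.of (φ d) := fun d => by
    simp [Formal.of, Finsupp.mapDomain_single]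
  have hsub : ∀ x y : Formal k l, Finsupp.mapDomain φ (x - y)
      = Finsupp.mapDomain φ x - Finsupp.mapDomain φ y := fun x y =>
    map_sub (Finsupp.lmapDomain K K φ) x y
  have hctx : ∀ (d : Diag k l) (p u q : List Slice), d.1 = p ++ u ++ q →
      (φ d).1 = (p₀ ++ p.map (Slice.shift a)) ++ u.map (Slice.shift a)
        ++ (q.map (Slice.shift a) ++ q₀) := fun d p u q h => by
    rw [hφ, h]; simp
  apply Submodule.subset_span
  cases hx with
  | isotopy d d' h =>
    obtain ⟨p, u, v, q, hm, h1, h2⟩ := h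
    rw [hsub, hof, hof]
    exact SkeinRel.isotopy _ _ ⟨_, _, _, _, hm.shift a, hctx _ _ _ _ h1, hctx _ _ _ _ h2⟩
  | cross_true d dh dv p q i h1 h2 h3 =>
    rw [hsub, hsub, Finsupp.mapDomain_smul, Finsupp.mapDomain_smul, hof, hof, hof]
    exact SkeinRel.cross_true _ _ _ _ _ (a + i) (hctx _ _ _ _ h1) (hctx _ _ _ _ h2)
      (hctx _ _ _ _ h3)
  | cross_false d dh dv p q i h1 h2 h3 =>
    rw [hsub, hsub, Finsupp.mapDomain_smul, Finsupp.mapDomain_smul, hof, hof, hof]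
    exact SkeinRel.cross_false _ _ _ _ _ (a + i) (hctx _ _ _ _ h1) (hctx _ _ _ _ h2)
      (hctx _ _ _ _ h3)
  | circle d d' p q i h1 h2 =>
    rw [hsub, Finsupp.mapDomain_smul, hof, hof]
    exact SkeinRel.circle _ _ _ _ (a + i) (hctx _ _ _ _ h1) (hctx _ _ _ _ h2)

/-- The linear map of skein modules induced by an operation on diagrams that adds strands on the
left and stacks fixed diagrams above and below. -/
noncomputable def Skein.induced {k l k' l' : ℕ} (a : ℕ) (p₀ q₀ : List Slice)
    (φ : Diag k l → Diag k' l') (hφ : ∀ d, (φ d).1 = p₀ ++ d.1.map (Slice.shift a) ++ q₀) :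
    Skein k l →ₗ[K] Skein k' l' :=
  Submodule.mapQ (skeinRelations k l) (skeinRelations k' l') (Finsupp.lmapDomain K K φ)
    (Submodule.span_le.2 fun _ hx => SkeinRel.map a p₀ q₀ φ hφ hx)

theorem Slice.shift_zero : Slice.shift 0 = _root_.id := by
  funext s; cases s; simp [Slice.shift]

/-- Add `r` vertical strands on the right. -/
noncomputable def Skein.addRight {k l : ℕ} (r : ℕ) : Skein k l →ₗ[K] Skein (k + r) (l + r) :=
  Skein.induced 0 [] [] (Diag.addRight r) fun d => by simp [Diag.addRight, Slice.shift_zero]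

/-- Add `a` vertical strands on the left. -/
noncomputable def Skein.addLeft {k l : ℕ} (a : ℕ) : Skein k l →ₗ[K] Skein (a + k) (a + l) :=
  Skein.induced a [] [] (Diag.addLeft a) fun d => by simp [Diag.addLeft]

/-- Stack the diagram `d` above an element of the skein module. -/
noncomputable def Skein.under {k l m : ℕ} (d : Diag k l) : Skein l m →ₗ[K] Skein k m :=
  Skein.induced 0 d.1 [] (Diag.comp d) fun d' => by simp [Diag.comp, Slice.shift_zero]

/-- Stack the diagram `d` below an element of the skein module. -/
noncomputable def Skein.above {k l m : ℕ} (d : Diag l m) : Skein k l →ₗ[K] Skein k m :=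
  Skein.induced 0 [] d.1 (fun d' => Diag.comp d' d) fun d' => by
    simp [Diag.comp, Slice.shift_zero]

theorem Skein.under_of {k l m : ℕ} (d : Diag k l) (d' : Diag l m) :
    Skein.under d (Skein.of d') = Skein.of (d.comp d') := by
  exact congrArg (skeinRelations k m).mkQ Finsupp.mapDomain_single

theorem Skein.above_of {k l m : ℕ} (d : Diag l m) (d' : Diag k l) :
    Skein.above d (Skein.of d') = Skein.of (d'.comp d) := by
  exact congrArg (skeinRelations k m).mkQ Finsupp.mapDomain_single

theorem Skein.comp_aux {k l m : ℕ} (x : Formal k l) (d' : Diag l m) :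
    Finsupp.linearCombination K (fun d : Diag k l => Skein.under (m := m) d) x (Skein.of d') =
      Skein.above d' ((skeinRelations k l).mkQ x) := by
  induction x using Finsupp.induction_linear with
  | zero => simp
  | add x y hx hy => rw [map_add, map_add, map_add, LinearMap.add_apply, hx, hy]
  | single d c =>
    have : (Finsupp.single d c : Formal k l) = c • Formal.of d := by simp [Formal.of]
    rw [Finsupp.linearCombination_single, LinearMap.smul_apply, Skein.under_of, this, map_smul,
      map_smul]
    exact congrArg (c • ·) (Skein.above_of d' d).symm

theorem Skein.hom_ext {k l : ℕ} {V : Type*} [AddCommGroup V] [Module K V]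
    {f g : Skein k l →ₗ[K] V} (h : ∀ d, f (Skein.of d) = g (Skein.of d)) : f = g := by
  apply Submodule.linearMap_qext
  apply Finsupp.lhom_ext'
  intro d
  apply LinearMap.ext_ring
  exact h d

/-- Vertical juxtaposition of skein elements, the first one on top of the second one: the bilinear
extension of `Diag.comp`. -/
noncomputable def Skein.comp {k l m : ℕ} : Skein k l →ₗ[K] Skein l m →ₗ[K] Skein k m :=
  Submodule.liftQ (skeinRelations k l)
    (Finsupp.linearCombination K fun d : Diag k l => Skein.under d) <| by
      intro x hx
      rw [LinearMap.mem_ker]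
      apply Skein.hom_ext
      intro d'
      rw [Skein.comp_aux, Submodule.mkQ_apply, (Submodule.Quotient.mk_eq_zero _).2 hx]
      simp

theorem Skein.comp_of {k l m : ℕ} (d : Diag k l) (d' : Diag l m) :
    Skein.comp (Skein.of d) (Skein.of d') = Skein.of (d.comp d') := by
  rw [← Skein.under_of]
  simp [Skein.comp, Skein.of, Formal.of]

/-! ### The Jones–Wenzl projectors -/

/-- The values `Δ₀ = 1`, `Δ₁ = δ`, `Δₙ₊₂ = δ Δₙ₊₁ - Δₙ`. -/
noncomputable def delta : ℕ → K
  | 0 => 1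
  | 1 => loopValue
  | n + 2 => loopValue * delta (n + 1) - delta n

/-- The generator of the Temperley–Lieb algebra on `n + 2` strands with a hook at the last two
strands. -/
def hook (n : ℕ) : Diag (n + 2) (n + 2) :=
  ⟨[cup n, cap n], by simp [IsDiag, Elem.top, Elem.bot]⟩

/-- The `n`-th Jones–Wenzl projector in the Temperley–Lieb algebra on `n` strands, by Wenzl's
recursion `f⁽ⁿ⁺²⁾ = g - (Δₙ / Δₙ₊₁) g eₙ₊₁ g`, where `g = f⁽ⁿ⁺¹⁾ ⊗ 1`. -/
noncomputable def jonesWenzl : (n : ℕ) → Skein n n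
  | 0 => Skein.of (Diag.id 0)
  | 1 => Skein.of (Diag.id 1)
  | n + 2 =>
    let g : Skein (n + 2) (n + 2) := Skein.addRight 1 (jonesWenzl (n + 1))
    g - (delta n / delta (n + 1)) • Skein.comp (Skein.comp g (Skein.of (hook n))) g

/-- `k` clusters of `n` strands with the projector `f⁽ⁿ⁾` placed on each cluster. -/
noncomputable def projectors (n : ℕ) : (k : ℕ) → Skein (n * k) (n * k)
  | 0 => Skein.of (Diag.id (n * 0))
  | k + 1 =>
    Skein.comp (Skein.addRight n (projectors n k)) (Skein.addLeft (n * k) (jonesWenzl n))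

/-! ### Colored tangles and colored disc modules -/

/-- The `n`-th parallel (in the blackboard framing) of a slice: each strand is replaced by `n` parallel
strands.  A maximum becomes `n` nested maxima, a minimum `n` nested minima, and a crossing a grid of
`n × n` crossings of the same kind. -/
def Slice.cable (n : ℕ) : Slice → List Slice
  | ⟨.cap, i⟩ => (List.range' (n * i) n).map cap
  | ⟨.cup, i⟩ => (List.range' (n * i) n).reverse.map cup
  | ⟨.cross b, i⟩ =>
    (List.range n).flatMap fun j => (List.range' (n * i + j) n).reverse.map (cross b)

theorem isDiag_caps (n : ℕ) : ∀ i k : ℕ, i ≤ k →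
    IsDiag ((List.range' i n).map cap) k (k + 2 * n) := by
  induction n with
  | zero => intro i k _; simp [IsDiag]
  | succ n ih =>
    intro i k h
    refine ⟨by simpa [Elem.top] using h, ?_⟩
    have := ih (i + 1) (k + 2) (by omega)
    rwa [show k + 2 + 2 * n = k + 2 * (n + 1) by ring] at this

theorem isDiag_cups (n : ℕ) : ∀ i k : ℕ, i ≤ k →
    IsDiag ((List.range' i n).reverse.map cup) (k + 2 * n) k := by
  induction n with
  | zero => intro i k _; simp [IsDiag]
  | succ n ih =>
    intro i k h
    have h1 := ih (i + 1) (k + 2) (by omega)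
    have h2 : IsDiag [cup i] (k + 2) k := by simp [IsDiag, Elem.top, Elem.bot, h]
    have h3 := h1.append h2
    rw [show k + 2 + 2 * n = k + 2 * (n + 1) by ring] at h3
    simpa [List.range'_succ] using h3

theorem isDiag_crosses (k : ℕ) (w : List Slice)
    (h : ∀ s ∈ w, ∃ b i, s = cross b i ∧ i + 2 ≤ k) : IsDiag w k k := by
  induction w with
  | nil => rfl
  | cons s w ih =>
    obtain ⟨b, i, rfl, hi⟩ := h s (by simp)
    refine ⟨hi, ?_⟩
    have := ih fun t ht => h t (by simp [ht])
    rwa [show k - (cross b i).elem.top + (cross b i).elem.bot = k by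
      simp only [Elem.top, Elem.bot]; omega]

theorem Slice.isDiag_cable (n : ℕ) (s : Slice) (k : ℕ) (h : s.pos + s.elem.top ≤ k) :
    IsDiag (s.cable n) (n * k) (n * (k - s.elem.top + s.elem.bot)) := by
  obtain ⟨e, i⟩ := s
  cases e with
  | cap =>
    simp only [Elem.top, Elem.bot, Slice.cable] at h ⊢
    have := isDiag_caps n (n * i) (n * k) (Nat.mul_le_mul_left n (by omega))
    rwa [show n * k + 2 * n = n * (k - 0 + 2) by rw [Nat.sub_zero]; ring] at this
  | cup =>
    simp only [Elem.top, Elem.bot, Slice.cable] at h ⊢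
    obtain ⟨r, rfl⟩ := Nat.exists_eq_add_of_le h
    have := isDiag_cups n (n * i) (n * (i + r)) (Nat.mul_le_mul_left n (by omega))
    rwa [show n * (i + r) + 2 * n = n * (i + 2 + r) by ring,
      show n * (i + r) = n * (i + 2 + r - 2 + 0) by congr 1; omega] at this
  | cross b =>
    simp only [Elem.top, Elem.bot, Slice.cable] at h ⊢
    rw [show k - 2 + 2 = k by omega]
    apply isDiag_crosses
    intro s hs
    simp only [List.mem_flatMap, List.mem_range, List.mem_map, List.mem_reverse,
      List.mem_range'_1] at hs
    obtain ⟨j, hj, t, ⟨_, ht⟩, rfl⟩ := hs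
    refine ⟨b, t, rfl, ?_⟩
    have := Nat.mul_le_mul_left n h
    rw [show n * (i + 2) = n * i + 2 * n by ring] at this
    omega

/-- The `n`-th parallel of a slice whose upper level has `k` strands, as a skein element. -/
noncomputable def Slice.cableSkein (n : ℕ) (s : Slice) (k : ℕ) (h : s.pos + s.elem.top ≤ k) :
    Skein (n * k) (n * (k - s.elem.top + s.elem.bot)) :=
  Skein.of ⟨s.cable n, s.isDiag_cable n k h⟩

/-- Replace each strand of a diagram by `n` parallel strands and insert the projector `f⁽ⁿ⁾` on
each strand of each level between two consecutive slices, as well as on the top and on the bottom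
level.  So each component, closed or not, carries the projector; as `f⁽ⁿ⁾` is an idempotent that
slides along a component, it does not matter how often it is inserted. -/
noncomputable def colorWord (n : ℕ) :
    (w : List Slice) → (k l : ℕ) → IsDiag w k l → Skein (n * k) (n * l)
  | [], k, _, h => Eq.rec (motive := fun l _ => Skein (n * k) (n * l)) (projectors n k) h
  | s :: w, k, l, h =>
    Skein.comp (Skein.comp (projectors n k) (s.cableSkein n k h.1)) (colorWord n w _ l h.2)

/-- Place idempotents on the outside of the disc: `n`-strand projectors at the `k` clusters on the top
and at the `l` clusters on the bottom. -/
noncomputable def sandwich (n k l : ℕ) : Skein (n * k) (n * l) →ₗ[K] Skein (n * k) (n * l) :=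
  (Skein.comp.flip (projectors n l)) ∘ₗ (Skein.comp (projectors n k))

/-- The module `𝒟ᵏₗ(n)`: the submodule of the skein module of the disc with `k` clusters of `n` points on
the top and `l` clusters of `n` points on the bottom that consists of the elements with a
projector placed at each cluster. -/
noncomputable def ColoredDisc (k l n : ℕ) : Submodule K (Skein (n * k) (n * l)) :=
  LinearMap.range (sandwich n k l)

/-- The `n`-th colored tangle `Tⁿ`, as an element of `𝒟ᵏₗ(n)`. -/
noncomputable def coloredTangle (n : ℕ) {k l : ℕ} (T : Diag k l) : ColoredDisc k l n :=
  ⟨sandwich n k l (colorWord n T.1 k l T.2), LinearMap.mem_range_self _ _⟩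

/-- The coefficients `γᵢ(T)` in the expansion `Tⁿ = ∑ᵢ γᵢ(T) Eᵢ`. -/
noncomputable def gamma {k l n s : ℕ} (E : Module.Basis (Fin (s + 1)) K (ColoredDisc k l n))
    (T : Diag k l) (i : Fin (s + 1)) : K :=
  E.repr (coloredTangle n T) i

end TangleSkein

namespace TangleSkein

/-! ### Planar calculus

An algebra generated by caps and cups on a strip with infinitely many strands on the right. -/

/-! It suffices that ambient isotopic diagrams have proportional colored tangles: if `Tⁿ = c • T'ⁿ`
with `c ≠ 0`, all coordinates in a basis are scaled by the same `c`, which cancels in the ratios.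
Planar isotopies and the moves II and III leave `Tⁿ` unchanged, because cabled diagrams slide
through each other and the projectors slide along strands. Only move I contributes a factor. A curl
on `n` parallel strands is an endomorphism of `n` points; modulo the Kauffman relations it is a
combination of planar diagrams with all cups above all caps, and `f⁽ⁿ⁾` kills every such diagram
except the identity. Hence the curl becomes a scalar (`Hom.jonesWenzl_mul`).

The scalar is never computed. That it may be taken nonzero follows from a Whitney trick: two
opposite curls on the two legs of `n` nested minima cancel by regular isotopy alone
(`curlRight_mul_shift_curlRight`, `shift_curlLeft_mul_curlLeft`), so the scalars of opposite curls
have product `1` on `f⁽ⁿ⁾`.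

The calculations take place in one ungraded algebra, so that products need no matching of widths.
`PlanarCalculus` lists the relations that are needed; `Hom k l x` records the numbers of end points,
and crossings are defined by their smoothings. The naturality statement `Hom.mul_braid` (any element
slides through a bundle of strands) then yields the cabled slide moves and move III, and
`jonesWenzl_aux` gives the properties of the projectors.

The bridge to the skein modules is `StripAlgebra`: combinations of words of slices, identified when
their skein classes agree after adding sufficiently many strands on the right. Each `Skein k l`
embeds in it (`toStrip_injective`), since closing up an added strand multiplies by `δ ≠ 0`. The
embedding takes `colorWord` to `PlanarCalculus.colored`, so proportionality can be pulled back. -/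

theorem mul_mul_of_mul_eq {B : Type*} [Semigroup B] {a b c : B} (h : a * b = c) (x : B) :
    a * (b * x) = c * x := by rw [← mul_assoc, h]

/-- An algebra in which caps and cups can be multiplied irrespective of the number of strands; the
strands are numbered from the left, and `shift a` adds `a` strands on the left. -/
structure PlanarCalculus (B : Type*) [Ring B] [Algebra K B] where
  cap : ℕ → B
  cup : ℕ → B
  shift : ℕ → B →ₐ[K] B
  shift_zero : ∀ x, shift 0 x = x
  shift_shift : ∀ a b x, shift a (shift b x) = shift (a + b) x
  shift_cap : ∀ a i, shift a (cap i) = cap (a + i)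
  shift_cup : ∀ a i, shift a (cup i) = cup (a + i)
  -- The relations are postulated at the left edge only; `shift` carries them to all positions. As
  -- `y` is arbitrary, the two `far` axioms contain every exchange of heights with a cap or a cup.
  cap_far : ∀ y, cap 0 * shift 2 y = y * cap 0
  cup_far : ∀ y, cup 0 * y = shift 2 y * cup 0
  cap_one_cup_zero : cap 1 * cup 0 = 1
  cap_zero_cup_one : cap 0 * cup 1 = 1
  circle : cap 0 * cup 0 = loopValue • 1

namespace PlanarCalculus

open MulOpposite

variable {B : Type*} [Ring B] [Algebra K B] (D : PlanarCalculus B)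

/-- The calculus reflected in a horizontal line. -/
noncomputable def op : PlanarCalculus Bᵐᵒᵖ where
  cap i := MulOpposite.op (D.cup i)
  cup i := MulOpposite.op (D.cap i)
  shift a := AlgHom.op (D.shift a)
  shift_zero x := by simp [D.shift_zero]
  shift_shift a b x := by simp [D.shift_shift]
  shift_cap a i := by simp [D.shift_cup]
  shift_cup a i := by simp [D.shift_cap]
  cap_far y := by
    apply MulOpposite.unop_injective
    simpa using (D.cup_far y.unop).symm
  cup_far y := by
    apply MulOpposite.unop_injective
    simpa using (D.cap_far y.unop).symm
  cap_one_cup_zero := by rw [← op_mul, D.cap_zero_cup_one, op_one]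
  cap_zero_cup_one := by rw [← op_mul, D.cap_one_cup_zero, op_one]
  circle := by rw [← op_mul, D.circle, op_smul, op_one]

theorem op_shift (a : ℕ) (x : B) :
    D.op.shift a (MulOpposite.op x) = MulOpposite.op (D.shift a x) := rfl

theorem cap_mul_shift (i : ℕ) (y : B) :
    D.cap i * D.shift (i + 2) y = D.shift i y * D.cap i := by
  have := congrArg (D.shift i) (D.cap_far y)
  simpa [D.shift_shift, D.shift_cap] using this

theorem cup_mul_shift (i : ℕ) (y : B) :
    D.cup i * D.shift i y = D.shift (i + 2) y * D.cup i := by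
  have := congrArg (D.shift i) (D.cup_far y)
  simpa [D.shift_shift, D.shift_cup] using this

theorem cap_succ_cup (i : ℕ) : D.cap (i + 1) * D.cup i = 1 := by
  have := congrArg (D.shift i) D.cap_one_cup_zero
  simpa [D.shift_cap, D.shift_cup] using this

theorem cap_cup_succ (i : ℕ) : D.cap i * D.cup (i + 1) = 1 := by
  have := congrArg (D.shift i) D.cap_zero_cup_one
  simpa [D.shift_cap, D.shift_cup] using this

theorem cap_cup (i : ℕ) : D.cap i * D.cup i = loopValue • 1 := by
  have := congrArg (D.shift i) D.circle
  simpa [D.shift_cap, D.shift_cup] using this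

theorem cap_cap_far (i d : ℕ) :
    D.cap i * D.cap (i + 2 + d) = D.cap (i + d) * D.cap i := by
  simpa [D.shift_cap] using D.cap_mul_shift i (D.cap d)

theorem cap_cup_far (i d : ℕ) :
    D.cap i * D.cup (i + 2 + d) = D.cup (i + d) * D.cap i := by
  simpa [D.shift_cup] using D.cap_mul_shift i (D.cup d)

theorem cup_cap_far (i d : ℕ) :
    D.cup i * D.cap (i + d) = D.cap (i + 2 + d) * D.cup i := by
  simpa [D.shift_cap] using D.cup_mul_shift i (D.cap d)

/-- The elements that are represented by linear combinations of diagrams with `k` end points on the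
top and `l` end points on the bottom. -/
inductive Hom : ℕ → ℕ → B → Prop
  | one (k) : Hom k k 1
  | cap (k i) : i ≤ k → Hom k (k + 2) (D.cap i)
  | cup (k i) : i ≤ k → Hom (k + 2) k (D.cup i)
  | mul {k l m x y} : Hom k l x → Hom l m y → Hom k m (x * y)
  | add {k l x y} : Hom k l x → Hom k l y → Hom k l (x + y)
  | smul {k l x} (c : K) : Hom k l x → Hom k l (c • x)

variable {D}

theorem Hom.sub {k l : ℕ} {x y : B} (hx : D.Hom k l x) (hy : D.Hom k l y) :
    D.Hom k l (x - y) := by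
  rw [sub_eq_add_neg, ← neg_one_smul K y]
  exact hx.add (hy.smul _)

theorem Hom.shift {k l : ℕ} {x : B} (a : ℕ) (h : D.Hom k l x) :
    D.Hom (a + k) (a + l) (D.shift a x) := by
  induction h with
  | one k => rw [map_one]; exact .one _
  | cap k i h => rw [D.shift_cap]; exact .cap (a + k) _ (by omega)
  | cup k i h => rw [D.shift_cup]; exact .cup (a + k) _ (by omega)
  | mul _ _ hx hy => rw [map_mul]; exact hx.mul hy
  | add _ _ hx hy => rw [map_add]; exact hx.add hy
  | smul c _ hx => rw [map_smul]; exact hx.smul c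

theorem Hom.right {k l : ℕ} {x : B} (r : ℕ) (h : D.Hom k l x) : D.Hom (k + r) (l + r) x := by
  induction h with
  | one k => exact .one _
  | cap k i h => rw [Nat.add_right_comm]; exact .cap _ _ (by omega)
  | cup k i h => rw [Nat.add_right_comm]; exact .cup _ _ (by omega)
  | mul _ _ hx hy => exact hx.mul hy
  | add _ _ hx hy => exact hx.add hy
  | smul c _ hx => exact hx.smul c

/-- Diagrams with disjoint supports exchange their heights. -/
theorem Hom.comm {k l : ℕ} {x : B} (h : D.Hom k l x) (y : B) :
    x * D.shift l y = D.shift k y * x := by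
  induction h generalizing y with
  | one k => rw [one_mul, mul_one]
  | cap k i h =>
    obtain ⟨r, rfl⟩ := Nat.exists_eq_add_of_le h
    rw [Nat.add_right_comm, ← D.shift_shift, D.cap_mul_shift, D.shift_shift]
  | cup k i h =>
    obtain ⟨r, rfl⟩ := Nat.exists_eq_add_of_le h
    rw [Nat.add_right_comm, ← D.shift_shift, D.cup_mul_shift, D.shift_shift]
  | mul _ _ hx hy => rw [mul_assoc, hy, ← mul_assoc, hx, mul_assoc]
  | add _ _ hx hy => rw [add_mul, mul_add, hx, hy]
  | smul c _ hx => rw [smul_mul_assoc, mul_smul_comm, hx]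

variable (D)

/-- The generators of the Temperley–Lieb algebras. -/
def hook (i : ℕ) : B := D.cup i * D.cap i

theorem op_hook (i : ℕ) : D.op.hook i = MulOpposite.op (D.hook i) := rfl

theorem shift_hook (a i : ℕ) : D.shift a (D.hook i) = D.hook (a + i) := by
  simp [hook, D.shift_cap, D.shift_cup]

theorem hom_hook {k i : ℕ} (h : i + 2 ≤ k) : D.Hom k k (D.hook i) := by
  obtain ⟨r, rfl⟩ := Nat.exists_eq_add_of_le h
  have := (Hom.cup (D := D) (i + r) i (by omega)).mul (.cap (i + r) i (by omega))
  rwa [Nat.add_right_comm] at this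

theorem hook_mul_hook (i : ℕ) : D.hook i * D.hook i = loopValue • D.hook i := by
  simp only [hook, mul_assoc]
  rw [mul_mul_of_mul_eq (D.cap_cup i)]
  simp

/-! ### Values of circles -/

theorem A_ne_zero : A ≠ 0 := RatFunc.X_ne_zero

theorem A_pow_ne_one {m : ℕ} (hm : m ≠ 0) : A ^ m ≠ 1 := by
  intro h
  have h1 : (algebraMap (Polynomial ℚ) K) (Polynomial.X ^ m) = algebraMap (Polynomial ℚ) K 1 := by
    simpa [A] using h
  have h2 := RatFunc.algebraMap_injective ℚ h1
  have := congrArg Polynomial.natDegree h2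
  simp at this
  exact hm this

/-- `Δₘ` is a signed quantum integer. Two consecutive values are treated together because the
recursion has depth two. -/
theorem delta_formula (m : ℕ) :
    (A ^ 2 - A⁻¹ ^ 2) * delta m = (-1) ^ m * (A ^ (2 * m + 2) - A⁻¹ ^ (2 * m + 2)) ∧
    (A ^ 2 - A⁻¹ ^ 2) * delta (m + 1) =
      (-1) ^ (m + 1) * (A ^ (2 * m + 4) - A⁻¹ ^ (2 * m + 4)) := by
  have hA : A ^ 2 * A⁻¹ ^ 2 = 1 := by
    rw [← mul_pow, mul_inv_cancel₀ A_ne_zero, one_pow]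
  induction m with
  | zero => constructor <;> simp [delta, loopValue]; ring
  | succ m ih =>
    refine ⟨by simpa [Nat.mul_add] using ih.2, ?_⟩
    rw [delta, mul_sub, mul_left_comm, ih.1, ih.2, loopValue]
    linear_combination (-1) ^ (m + 1) * (A⁻¹ ^ (2 * m + 2) - A ^ (2 * m + 2)) * hA

/-- A zero would make the indeterminate `A` a root of unity. Wenzl's recursion divides by these
values, and the case of `δ` gives the embedding into the strip algebra. -/
theorem delta_ne_zero (m : ℕ) : delta m ≠ 0 := by
  intro h
  have h1 := (delta_formula m).1
  rw [h, mul_zero] at h1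
  have h2 : A ^ (2 * m + 2) = A⁻¹ ^ (2 * m + 2) := by
    have : ((-1 : K)) ^ m ≠ 0 := pow_ne_zero _ (by norm_num)
    have := (mul_eq_zero.1 h1.symm).resolve_left this
    exact sub_eq_zero.1 this
  apply A_pow_ne_one (m := (2 * m + 2) + (2 * m + 2)) (by omega)
  rw [pow_add]
  nth_rw 2 [h2]
  rw [← mul_pow, mul_inv_cancel₀ A_ne_zero, one_pow]

/-! ### Jones–Wenzl projectors -/

/-- The Jones–Wenzl projectors. -/
noncomputable def jonesWenzl : ℕ → B
  | 0 => 1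
  | 1 => 1
  | n + 2 => jonesWenzl (n + 1) -
      (delta n / delta (n + 1)) • (jonesWenzl (n + 1) * D.hook n * jonesWenzl (n + 1))

theorem op_jonesWenzl (n : ℕ) : D.op.jonesWenzl n = MulOpposite.op (D.jonesWenzl n) := by
  induction n using Nat.twoStepInduction with
  | zero => rfl
  | one => rfl
  | more n _ ih =>
    rw [jonesWenzl, jonesWenzl, ih, op_hook]
    simp [mul_assoc]

theorem hom_jonesWenzl (n : ℕ) : D.Hom n n (D.jonesWenzl n) := by
  induction n using Nat.twoStepInduction with
  | zero => exact .one _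
  | one => exact .one _
  | more n _ ih =>
    have := ih.right 1
    exact this.sub (((this.mul (D.hom_hook (by omega))).mul this).smul _)

/-- The four properties feed each other and need one induction: the partial trace of `f⁽ᵐ⁺¹⁾`
determines `eₘ f⁽ᵐ⁺¹⁾ eₘ`, which makes the coefficient in Wenzl's recursion exactly the one for
which the last hook annihilates `f⁽ᵐ⁺²⁾`; this annihilation gives idempotence, and the recursion for
`Δ` gives the next partial trace. -/
theorem jonesWenzl_aux (m : ℕ) :
    D.jonesWenzl m * D.jonesWenzl (m + 1) = D.jonesWenzl (m + 1) ∧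
    D.jonesWenzl (m + 1) * D.jonesWenzl (m + 1) = D.jonesWenzl (m + 1) ∧
    D.cap m * D.jonesWenzl (m + 1) * D.cup m = (delta (m + 1) / delta m) • D.jonesWenzl m ∧
    ∀ i < m, D.hook i * D.jonesWenzl (m + 1) = 0 := by
  induction m with
  | zero => simp [jonesWenzl, D.cap_cup, delta]
  | succ m ih =>
    obtain ⟨ih1, ih2, ih3, ih4⟩ := ih
    set f := D.jonesWenzl m with hf
    set g := D.jonesWenzl (m + 1) with hg
    set c := delta m / delta (m + 1) with hc
    have hcm := delta_ne_zero m
    have hcm' := delta_ne_zero (m + 1)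
    have hrec : D.jonesWenzl (m + 1 + 1) = g - c • (g * D.hook m * g) := rfl
    set h := D.jonesWenzl (m + 1 + 1) with hh
    have hcapg : D.cap (m + 1) * g = g * D.cap (m + 1) := by
      simpa [D.shift_cap] using ((D.hom_jonesWenzl (m + 1)).comm (D.cap 0)).symm
    have hcupg : D.cup (m + 1) * g = g * D.cup (m + 1) := by
      simpa [D.shift_cup] using ((D.hom_jonesWenzl (m + 1)).comm (D.cup 0)).symm
    have hcupf : D.cup m * f = f * D.cup m := by
      simpa [D.shift_cup] using ((D.hom_jonesWenzl m).comm (D.cup 0)).symm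
    have heg : D.hook m * (g * D.hook m) = (delta (m + 1) / delta m) • (f * D.hook m) := by
      calc D.hook m * (g * D.hook m) = D.cup m * (D.cap m * g * D.cup m) * D.cap m := by
            simp only [hook, mul_assoc]
        _ = _ := by
            rw [ih3, mul_smul_comm, hcupf, smul_mul_assoc, mul_assoc, hook]
    have heh : D.hook m * h = 0 := by
      rw [hrec, mul_sub, mul_smul_comm, ← mul_assoc, heg, smul_mul_assoc, smul_smul]
      -- The coefficient of the recursion is the inverse of the partial trace factor, so the two
      -- terms cancel once `f` is moved past the hook and absorbed by `g`.
      rw [show c * (delta (m + 1) / delta m) = 1 by rw [hc]; field_simp, one_smul, mul_assoc]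
      rw [show f * (D.hook m * g) = D.hook m * (f * g) by
        rw [← mul_assoc, ← mul_assoc]
        congr 1
        simpa [D.shift_hook] using (D.hom_jonesWenzl m).comm (D.hook 0)]
      rw [ih1, sub_self]
    have hgh : g * h = h := by
      rw [hrec, mul_sub, mul_smul_comm, ← mul_assoc, ← mul_assoc, ih2]
    have hhh : h * h = h := by
      nth_rw 1 [hrec]
      rw [sub_mul, hgh, smul_mul_assoc, mul_assoc, hgh, mul_assoc, heh, mul_zero, smul_zero,
        sub_zero]
    refine ⟨hgh, hhh, ?_, ?_⟩
    · have h1 : D.cap (m + 1) * g * D.cup (m + 1) = loopValue • g := by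
        rw [hcapg, mul_assoc, D.cap_cup, mul_smul_comm, mul_one]
      -- Closing the last strand around the hook leaves two zigzags, which straighten.
      have h2 : D.cap (m + 1) * (g * D.hook m * g) * D.cup (m + 1) = g := by
        calc _ = D.cap (m + 1) * g * D.hook m * (g * D.cup (m + 1)) := by simp only [mul_assoc]
          _ = g * (D.cap (m + 1) * D.cup m) * (D.cap m * D.cup (m + 1)) * g := by
            rw [hcapg, ← hcupg]; simp only [hook, mul_assoc]
          _ = g := by rw [D.cap_succ_cup, D.cap_cup_succ, mul_one, mul_one, ih2]
      rw [hrec, mul_sub, sub_mul, h1, mul_smul_comm, smul_mul_assoc, h2, ← sub_smul]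
      congr 1
      rw [hc, delta]
      field_simp
    · intro i hi
      rcases Nat.lt_succ_iff_lt_or_eq.1 hi with hi | rfl
      · rw [← hgh, ← mul_assoc, ih4 i hi, zero_mul]
      · exact heh

theorem jonesWenzl_mul_self (n : ℕ) : D.jonesWenzl n * D.jonesWenzl n = D.jonesWenzl n := by
  cases n with
  | zero => simp [jonesWenzl]
  | succ n => exact (D.jonesWenzl_aux n).2.1

theorem hook_mul_jonesWenzl {n i : ℕ} (h : i + 2 ≤ n) : D.hook i * D.jonesWenzl n = 0 := by
  obtain ⟨n, rfl⟩ := Nat.exists_eq_succ_of_ne_zero (show n ≠ 0 by omega)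
  exact (D.jonesWenzl_aux n).2.2.2 i (by omega)

theorem jonesWenzl_mul_hook {n i : ℕ} (h : i + 2 ≤ n) : D.jonesWenzl n * D.hook i = 0 := by
  have := D.op.hook_mul_jonesWenzl h
  rw [op_hook, op_jonesWenzl, ← op_mul] at this
  exact MulOpposite.op_injective this

/-- A single cup already contains a hook: a zigzag inserted below it exhibits `hook i` as a left
factor. -/
theorem jonesWenzl_mul_cup {n i : ℕ} (h : i + 2 ≤ n) : D.jonesWenzl n * D.cup i = 0 := by
  have : D.cup i = D.hook i * D.cup (i + 1) := by
    rw [hook, mul_assoc, D.cap_cup_succ, mul_one]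
  rw [this, ← mul_assoc, D.jonesWenzl_mul_hook h, zero_mul]

/-- The difference of the projector and the identity is a combination of nonempty products of
hooks. -/
theorem jonesWenzl_sub_one_mem (n : ℕ) :
    D.jonesWenzl n - 1 ∈ NonUnitalAlgebra.adjoin K {x | ∃ i, i + 2 ≤ n ∧ x = D.hook i} := by
  induction n using Nat.twoStepInduction with
  | zero => simp [jonesWenzl]
  | one => simp [jonesWenzl]
  | more n _ ih =>
    have hle : NonUnitalAlgebra.adjoin K {x | ∃ i, i + 2 ≤ n + 1 ∧ x = D.hook i} ≤
        NonUnitalAlgebra.adjoin K {x | ∃ i, i + 2 ≤ n + 2 ∧ x = D.hook i} :=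
      NonUnitalAlgebra.adjoin_mono fun x ⟨i, hi, hx⟩ => ⟨i, by omega, hx⟩
    have h := hle ih
    have he : D.hook n ∈ NonUnitalAlgebra.adjoin K {x | ∃ i, i + 2 ≤ n + 2 ∧ x = D.hook i} :=
      NonUnitalAlgebra.subset_adjoin K ⟨n, le_rfl, rfl⟩
    set S := NonUnitalAlgebra.adjoin K {x | ∃ i, i + 2 ≤ n + 2 ∧ x = D.hook i}
    set h' := D.jonesWenzl (n + 1) - 1 with hh
    have hg : D.jonesWenzl (n + 1) = 1 + h' := by rw [hh]; abel
    rw [jonesWenzl, hg]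
    rw [show (1 + h' - (delta n / delta (n + 1)) • ((1 + h') * D.hook n * (1 + h')) - 1) =
      h' - (delta n / delta (n + 1)) •
        (D.hook n + h' * D.hook n + D.hook n * h' + h' * D.hook n * h') by
      rw [show (1 + h') * D.hook n * (1 + h') =
        D.hook n + h' * D.hook n + D.hook n * h' + h' * D.hook n * h' by noncomm_ring]
      abel]
    exact sub_mem h (SMulMemClass.smul_mem _ (add_mem (add_mem (add_mem he (mul_mem h he))
      (mul_mem he h)) (mul_mem (mul_mem h he) h)))

end PlanarCalculus

/-- The algebra behind Reidemeister II: with `t = δ = -A² - A⁻²`, the coefficient `a² + act + c²` of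
the hook in the product of two opposite crossings vanishes. -/
theorem smoothings_mul {R S : Type*} [CommRing R] [Ring S] [Algebra R S] {a c t : R} {x : S}
    (hx : x * x = t • x) (h : a * c = 1) (ht : a * a + t + c * c = 0) :
    (a • x + c • 1) * (a • 1 + c • x) = 1 ∧ (a • 1 + c • x) * (a • x + c • 1) = 1 := by
  have h1 : (a • x + c • 1) * (a • 1 + c • x) =
      (a * a + a * c * t + c * c) • x + (a * c) • (1 : S) := by
    simp only [add_mul, mul_add, smul_mul_assoc, mul_smul_comm, hx, mul_one, one_mul]
    module
  have h2 : (a • 1 + c • x) * (a • x + c • 1) =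
      (a * a + a * c * t + c * c) • x + (a * c) • (1 : S) := by
    simp only [add_mul, mul_add, smul_mul_assoc, mul_smul_comm, hx, mul_one, one_mul]
    module
  rw [h1, h2, h, one_mul, ht]
  simp

namespace PlanarCalculus

open MulOpposite

variable {B : Type*} [Ring B] [Algebra K B] (D : PlanarCalculus B)

/-! ### The normal form of planar diagrams -/

/-- Products of cups, from `k` strands to `l` strands. -/
inductive CupWord : ℕ → ℕ → B → Prop
  | nil (k) : CupWord k k 1
  | cons {k l x} (i) : i ≤ k → CupWord k l x → CupWord (k + 2) l (D.cup i * x)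

/-- Products of caps, from `k` strands to `l` strands. -/
inductive CapWord : ℕ → ℕ → B → Prop
  | nil (k) : CapWord k k 1
  | cons {k l x} (i) : i ≤ k → CapWord (k + 2) l x → CapWord k l (D.cap i * x)

/-- The span of the planar diagrams in which all cups are above all caps. -/
noncomputable def normalForms (k l : ℕ) : Submodule K B :=
  Submodule.span K {x | ∃ m u v, D.CupWord k m u ∧ D.CapWord m l v ∧ x = u * v}

variable {D}

theorem mul_mem_normalForms {k k' l : ℕ} {y : B}
    (h : ∀ m u v, D.CupWord k m u → D.CapWord m l v → y * (u * v) ∈ D.normalForms k' l)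
    {x : B} (hx : x ∈ D.normalForms k l) : y * x ∈ D.normalForms k' l := by
  induction hx using Submodule.span_induction with
  | mem x hx => obtain ⟨m, u, v, hu, hv, rfl⟩ := hx; exact h m u v hu hv
  | zero => rw [mul_zero]; exact zero_mem _
  | add x y _ _ hx hy => rw [mul_add]; exact add_mem hx hy
  | smul c x _ hx => rw [mul_smul_comm]; exact Submodule.smul_mem _ _ hx

theorem CupWord.mem {k l m : ℕ} {u v : B} (hu : D.CupWord k m u) (hv : D.CapWord m l v) :
    u * v ∈ D.normalForms k l :=
  Submodule.subset_span ⟨m, u, v, hu, hv, rfl⟩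

theorem cup_mul_mem_normalForms {k l i : ℕ} (h : i ≤ k) {x : B} (hx : x ∈ D.normalForms k l) :
    D.cup i * x ∈ D.normalForms (k + 2) l :=
  mul_mem_normalForms (fun m u v hu hv => by
    rw [← mul_assoc]; exact (CupWord.cons i h hu).mem hv) hx

/-- A cap above a word of cups is pushed down. Against the next cup it forms a zigzag (adjacent
positions), a circle (equal positions), or exchanges heights with it and meets a shorter word. -/
theorem CupWord.cap_mul_mem {k' l m : ℕ} {u v : B} (hu : D.CupWord k' m u)
    (hv : D.CapWord m l v) :
    ∀ {k i : ℕ}, k' = k + 2 → i ≤ k → D.cap i * (u * v) ∈ D.normalForms k l := by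
  induction hu with
  | nil k' =>
    rintro k i rfl h
    have := (CupWord.nil (D := D) k).mem (CapWord.cons i h hv)
    simpa using this
  | @cons k' m u j hj hu ih =>
    intro k i hk h
    obtain rfl : k' = k := by omega
    rw [mul_assoc]
    rcases lt_trichotomy i j with hij | rfl | hij
    · obtain ⟨d, rfl⟩ := Nat.exists_eq_add_of_lt hij
      cases d with
      | zero =>
        rw [Nat.add_zero, mul_mul_of_mul_eq (D.cap_cup_succ i), one_mul]
        exact hu.mem hv
      | succ d =>
        obtain ⟨k, rfl⟩ := Nat.exists_eq_add_of_le (show 2 ≤ k' by omega)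
        rw [show i + (d + 1) + 1 = i + 2 + d by ring, mul_mul_of_mul_eq (D.cap_cup_far i d),
          mul_assoc, Nat.add_comm 2 k]
        exact cup_mul_mem_normalForms (by omega) (ih hv (by omega) (by omega))
    · rw [mul_mul_of_mul_eq (D.cap_cup i), smul_mul_assoc, one_mul]
      exact Submodule.smul_mem _ _ (hu.mem hv)
    · obtain ⟨d, rfl⟩ := Nat.exists_eq_add_of_lt hij
      cases d with
      | zero =>
        rw [Nat.add_zero, mul_mul_of_mul_eq (D.cap_succ_cup j), one_mul]
        exact hu.mem hv
      | succ d =>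
        obtain ⟨k, rfl⟩ := Nat.exists_eq_add_of_le (show 2 ≤ k' by omega)
        rw [show j + (d + 1) + 1 = j + 2 + d by ring, mul_mul_of_mul_eq (D.cup_cap_far j d).symm,
          mul_assoc, Nat.add_comm 2 k]
        exact cup_mul_mem_normalForms (by omega) (ih hv (by omega) (by omega))

theorem Hom.mul_mem_normalForms {k l m : ℕ} {x z : B} (hx : D.Hom k l x)
    (hz : z ∈ D.normalForms l m) : x * z ∈ D.normalForms k m := by
  induction hx generalizing z with
  | one k => rwa [one_mul]
  | cap k i h =>
    exact PlanarCalculus.mul_mem_normalForms (fun m u v hu hv => hu.cap_mul_mem hv rfl h) hz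
  | cup k i h => exact cup_mul_mem_normalForms h hz
  | mul _ _ hx hy => rw [mul_assoc]; exact hx (hy hz)
  | add _ _ hx hy => rw [add_mul]; exact add_mem (hx hz) (hy hz)
  | smul c _ hx => rw [smul_mul_assoc]; exact Submodule.smul_mem _ _ (hx hz)

theorem Hom.mem_normalForms {k l : ℕ} {x : B} (hx : D.Hom k l x) : x ∈ D.normalForms k l := by
  have := hx.mul_mem_normalForms ((CupWord.nil (D := D) l).mem (CapWord.nil l))
  simpa using this

theorem CapWord.le {k l : ℕ} {x : B} (h : D.CapWord k l x) : k ≤ l := by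
  induction h with
  | nil => exact le_rfl
  | cons => omega

theorem CapWord.eq_one {k : ℕ} {x : B} (h : D.CapWord k k x) : x = 1 := by
  cases h with
  | nil => rfl
  | cons i _ h => have := h.le; omega

/-- The projector absorbs endomorphisms up to a scalar. -/
theorem Hom.jonesWenzl_mul {n : ℕ} {x : B} (hx : D.Hom n n x) :
    ∃ c : K, D.jonesWenzl n * x = c • D.jonesWenzl n := by
  have hx' := hx.mem_normalForms
  clear hx
  induction hx' using Submodule.span_induction with
  | mem x hx =>
    obtain ⟨m, u, v, hu, hv, rfl⟩ := hx
    cases hu with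
    -- Without cups the caps lead from `n` strands to `n` strands; each cap adds two, so there are
    -- none and the diagram is the identity.
    | nil => exact ⟨1, by rw [hv.eq_one, mul_one, mul_one, one_smul]⟩
    | cons i h hu =>
      refine ⟨0, ?_⟩
      rw [← mul_assoc, ← mul_assoc, D.jonesWenzl_mul_cup (by omega), zero_mul, zero_mul, zero_smul]
  | zero => exact ⟨0, by simp⟩
  | add x y _ _ hx hy =>
    obtain ⟨c, hc⟩ := hx
    obtain ⟨d, hd⟩ := hy
    exact ⟨c + d, by rw [mul_add, hc, hd, add_smul]⟩
  | smul a x _ hx =>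
    obtain ⟨c, hc⟩ := hx
    exact ⟨a * c, by rw [mul_smul_comm, hc, mul_smul]⟩

variable (D)

/-! ### Crossings -/

/-- The crossings, resolved by the Kauffman relation. -/
noncomputable def cross (b : Bool) (i : ℕ) : B :=
  if b then A • D.hook i + A⁻¹ • 1 else A • 1 + A⁻¹ • D.hook i

theorem op_cross (b : Bool) (i : ℕ) : D.op.cross b i = MulOpposite.op (D.cross b i) := by
  cases b <;> rfl

theorem shift_cross (b : Bool) (a i : ℕ) : D.shift a (D.cross b i) = D.cross b (a + i) := by
  cases b <;> simp [cross, shift_hook]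

theorem hom_cross (b : Bool) {i k : ℕ} (h : i + 2 ≤ k) : D.Hom k k (D.cross b i) := by
  cases b
  · exact ((Hom.one k).smul _).add ((D.hom_hook h).smul _)
  · exact ((D.hom_hook h).smul _).add ((Hom.one k).smul _)

theorem cross_mul_cross_not (b : Bool) (i : ℕ) : D.cross b i * D.cross (!b) i = 1 := by
  have h := smoothings_mul (D.hook_mul_hook i) (mul_inv_cancel₀ A_ne_zero)
    (by rw [loopValue]; ring)
  cases b
  · exact h.2
  · exact h.1

/-- Under a neighbouring cap the hook and the identity are exchanged between the two positions, so
the two smoothings swap coefficients and the crossing changes its sign. -/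
theorem cap_succ_cross (b : Bool) (i : ℕ) :
    D.cap (i + 1) * D.cross b i = D.cap i * D.cross (!b) (i + 1) := by
  have h1 : D.cap (i + 1) * D.hook i = D.cap i := by
    rw [hook, ← mul_assoc, D.cap_succ_cup, one_mul]
  have h2 : D.cap i * D.hook (i + 1) = D.cap (i + 1) := by
    rw [hook, ← mul_assoc, D.cap_cup_succ, one_mul]
  cases b <;> simp [cross, mul_add, h1, h2]

theorem cross_cup_succ (b : Bool) (i : ℕ) :
    D.cross b i * D.cup (i + 1) = D.cross (!b) (i + 1) * D.cup i := by
  have := D.op.cap_succ_cross b i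
  simp only [op_cross] at this
  exact MulOpposite.op_injective this

/-! ### One strand crossing several strands -/

/-- A strand crosses the `k` strands on its left. -/
noncomputable def crossLeft (b : Bool) : ℕ → B
  | 0 => 1
  | k + 1 => D.cross b k * crossLeft b k

/-- A strand crosses the `k` strands on its right. -/
noncomputable def crossRight (b : Bool) : ℕ → B
  | 0 => 1
  | k + 1 => crossRight b k * D.cross b k

theorem hom_crossLeft (b : Bool) (k : ℕ) : D.Hom (k + 1) (k + 1) (D.crossLeft b k) := by
  induction k with
  | zero => exact .one _
  | succ k ih => exact (D.hom_cross b (by omega)).mul (ih.right 1)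

theorem hom_crossRight (b : Bool) (k : ℕ) : D.Hom (k + 1) (k + 1) (D.crossRight b k) := by
  induction k with
  | zero => exact .one _
  | succ k ih => exact (ih.right 1).mul (D.hom_cross b (by omega))

theorem crossRight_mul_crossLeft (b : Bool) (k : ℕ) :
    D.crossRight b k * D.crossLeft (!b) k = 1 := by
  induction k with
  | zero => exact one_mul 1
  | succ k ih =>
    rw [crossRight, crossLeft, mul_assoc, mul_mul_of_mul_eq (D.cross_mul_cross_not b k), one_mul, ih]

theorem crossLeft_mul_crossRight (b : Bool) (k : ℕ) :
    D.crossLeft b k * D.crossRight (!b) k = 1 := by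
  induction k with
  | zero => exact one_mul 1
  | succ k ih =>
    rw [crossRight, crossLeft, mul_assoc, mul_mul_of_mul_eq ih, one_mul, D.cross_mul_cross_not]

theorem crossLeft_succ (b : Bool) (k : ℕ) :
    D.crossLeft b (k + 1) = D.shift 1 (D.crossLeft b k) * D.cross b 0 := by
  induction k with
  | zero => simp [crossLeft]
  | succ k ih =>
    nth_rw 2 [crossLeft]
    rw [map_mul, shift_cross, Nat.add_comm 1 k, mul_assoc, ← ih, crossLeft]

theorem crossLeft_add (b : Bool) (k m : ℕ) :
    D.crossLeft b (k + m) = D.shift k (D.crossLeft b m) * D.crossLeft b k := by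
  induction m with
  | zero => simp [crossLeft]
  | succ m ih => rw [← Nat.add_assoc, crossLeft, ih, crossLeft, map_mul, shift_cross, mul_assoc]

variable {D}

/-- Planar diagrams slide under or over a strand. -/
theorem Hom.mul_crossLeft {k l : ℕ} {x : B} (b : Bool) (h : D.Hom k l x) :
    x * D.crossLeft b l = D.crossLeft b k * D.shift 1 x := by
  -- `hadd` and `hshift` put idle strands on the right and on the left, so only `cap 0` and `cup 0`
  -- without further strands have to be treated.
  have hadd : ∀ {k l : ℕ} {x : B}, D.Hom k l x →
      x * D.crossLeft b l = D.crossLeft b k * D.shift 1 x → ∀ r,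
      x * D.crossLeft b (l + r) = D.crossLeft b (k + r) * D.shift 1 x := by
    intro k l x hx h r
    rw [crossLeft_add, crossLeft_add, ← mul_assoc, hx.comm, mul_assoc, h, mul_assoc]
  have hshift : ∀ {k l : ℕ} {x : B},
      x * D.crossLeft b l = D.crossLeft b k * D.shift 1 x → ∀ a,
      D.shift a x * D.crossLeft b (a + l) = D.crossLeft b (a + k) * D.shift 1 (D.shift a x) := by
    intro k l x h a
    rw [crossLeft_add, crossLeft_add, ← mul_assoc, ← map_mul, h, map_mul, mul_assoc, mul_assoc,
      D.shift_shift, D.shift_shift, Nat.add_comm 1 a, ← (D.hom_crossLeft b a).comm]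
  induction h with
  | one k => simp
  | cap k i h =>
    obtain ⟨r, rfl⟩ := Nat.exists_eq_add_of_le h
    have h0 : D.cap 0 * D.crossLeft b 2 = D.crossLeft b 0 * D.shift 1 (D.cap 0) := by
      have := D.cap_succ_cross (!b) 0
      rw [Bool.not_not] at this
      simp only [crossLeft, mul_one, one_mul, D.shift_cap]
      rw [← mul_assoc]
      rw [← this, mul_assoc]
      have := D.cross_mul_cross_not (!b) 0
      rw [Bool.not_not] at this
      rw [this, mul_one]
    have := hadd (Hom.shift i (Hom.cap (D := D) 0 0 le_rfl)) (hshift h0 i) r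
    rw [D.shift_cap] at this
    rw [Nat.add_right_comm]
    exact this
  | cup k i h =>
    obtain ⟨r, rfl⟩ := Nat.exists_eq_add_of_le h
    have h0 : D.cup 0 * D.crossLeft b 0 = D.crossLeft b 2 * D.shift 1 (D.cup 0) := by
      simp only [crossLeft, mul_one, D.shift_cup, mul_assoc]
      rw [Nat.add_comm 1 0, D.cross_cup_succ b 0, mul_mul_of_mul_eq (D.cross_mul_cross_not b 1),
        one_mul]
    have := hadd (Hom.shift i (Hom.cup (D := D) 0 0 le_rfl)) (hshift h0 i) r
    rw [D.shift_cup] at this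
    rw [Nat.add_right_comm]
    exact this
  | mul _ _ hx hy => rw [mul_assoc, hy, ← mul_assoc, hx, map_mul, mul_assoc]
  | add _ _ hx hy => rw [add_mul, map_add, mul_add, hx, hy]
  | smul c _ hx => rw [smul_mul_assoc, map_smul, mul_smul_comm, hx]

/-- `crossRight b` is inverse to `crossLeft (!b)`, so this is the previous sliding property
conjugated by the inverse. -/
theorem Hom.mul_crossRight {k l : ℕ} {x : B} (b : Bool) (h : D.Hom k l x) :
    D.shift 1 x * D.crossRight b l = D.crossRight b k * x := by
  have h1 := h.mul_crossLeft (!b)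
  have h2 := D.crossRight_mul_crossLeft b k
  have h3 := D.crossLeft_mul_crossRight (!b) l
  rw [Bool.not_not] at h3
  calc _ = D.crossRight b k * D.crossLeft (!b) k * (D.shift 1 x * D.crossRight b l) := by
        rw [h2, one_mul]
    _ = D.crossRight b k * (D.crossLeft (!b) k * D.shift 1 x) * D.crossRight b l := by
        simp only [mul_assoc]
    _ = _ := by rw [← h1, mul_assoc, mul_assoc, h3, mul_one]

variable (D)

/-! ### Bundles of strands crossing each other -/

/-- `k` strands on the left cross `q` strands on the right. -/
noncomputable def braid (b : Bool) (k : ℕ) : ℕ → B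
  | 0 => 1
  | q + 1 => braid b k q * D.shift q (D.crossLeft b k)

theorem hom_braid (b : Bool) (k q : ℕ) : D.Hom (k + q) (k + q) (D.braid b k q) := by
  induction q with
  | zero => exact .one _
  | succ q ih =>
    refine (ih.right 1).mul ?_
    have := (D.hom_crossLeft b k).shift q
    rwa [show q + (k + 1) = k + q + 1 by ring] at this

theorem braid_one (b : Bool) (k : ℕ) : D.braid b k 1 = D.crossLeft b k := by
  simp [braid, D.shift_zero]

theorem braid_add_right (b : Bool) (k q q' : ℕ) :
    D.braid b k (q + q') = D.braid b k q * D.shift q (D.braid b k q') := by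
  induction q' with
  | zero => simp [braid]
  | succ q' ih => rw [← Nat.add_assoc, braid, ih, braid, map_mul, D.shift_shift, mul_assoc]

theorem braid_zero_left (b : Bool) (q : ℕ) : D.braid b 0 q = 1 := by
  induction q with
  | zero => rfl
  | succ q ih => simp [braid, ih, crossLeft]

/-- The grid of crossings is defined by splitting off strands of the right bundle; here one strand
of the left bundle is split off, which makes induction on either bundle possible. -/
theorem braid_succ_left (b : Bool) (k q : ℕ) :
    D.braid b (k + 1) q = D.shift 1 (D.braid b k q) * D.crossRight b q := by
  induction q with
  | zero => simp [braid, crossRight]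
  | succ q ih =>
    have := (D.hom_crossRight b q).comm (D.crossLeft b k)
    rw [braid, braid, ih, crossLeft_succ, map_mul, map_mul, crossRight, D.shift_shift,
      D.shift_shift, shift_cross, mul_assoc, mul_mul_of_mul_eq this,
      Nat.add_comm 1 q]
    simp only [mul_assoc, Nat.add_zero]

theorem braid_add_left (b : Bool) (k k' q : ℕ) :
    D.braid b (k + k') q = D.shift k (D.braid b k' q) * D.braid b k q := by
  induction k with
  | zero => simp [braid_zero_left, D.shift_zero]
  | succ k ih =>
    rw [Nat.add_right_comm, braid_succ_left, ih, braid_succ_left, map_mul, D.shift_shift,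
      Nat.add_comm 1 k, mul_assoc]

theorem braid_mul_braid_not (b : Bool) (k q : ℕ) :
    D.braid b k q * D.braid (!b) q k = 1 := by
  induction k with
  | zero => simp [braid_zero_left, braid]
  | succ k ih =>
    rw [braid_succ_left, Nat.add_comm k 1, braid_add_right, braid_one, mul_assoc,
      mul_mul_of_mul_eq (D.crossRight_mul_crossLeft b q), one_mul, ← map_mul, ih, map_one]

variable {D}

/-- Naturality of the braiding in the left bundle; `Hom.shift_mul_braid` is the same for the right
bundle. Together they are the source of all cabled moves below. -/
theorem Hom.mul_braid {k l : ℕ} {x : B} (b : Bool) (q : ℕ) (h : D.Hom k l x) :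
    x * D.braid b l q = D.braid b k q * D.shift q x := by
  induction q with
  | zero => simp [braid, D.shift_zero]
  | succ q ih =>
    rw [braid, ← mul_assoc, ih, mul_assoc, ← map_mul, h.mul_crossLeft, map_mul, D.shift_shift,
      braid, mul_assoc]

theorem Hom.shift_mul_braid {l m : ℕ} {x : B} (b : Bool) (k : ℕ) (h : D.Hom l m x) :
    D.shift k x * D.braid b k m = D.braid b k l * x := by
  induction k with
  | zero => simp [braid_zero_left, D.shift_zero]
  | succ k ih =>
    rw [braid_succ_left, Nat.add_comm k 1, ← D.shift_shift, ← mul_assoc, ← map_mul, ih, map_mul,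
      mul_assoc, h.mul_crossRight, Nat.add_comm 1 k, braid_succ_left, mul_assoc]

variable (D)

/-! ### Nested caps and cups -/

/-- `n` nested caps. -/
noncomputable def caps : ℕ → B
  | 0 => 1
  | n + 1 => D.cap 0 * D.shift 1 (caps n)

/-- `n` nested cups. -/
noncomputable def cups : ℕ → B
  | 0 => 1
  | n + 1 => D.shift 1 (cups n) * D.cup 0

theorem op_caps (n : ℕ) : D.op.caps n = MulOpposite.op (D.cups n) := by
  induction n with
  | zero => rfl
  | succ n ih => rw [caps, ih, op_shift]; rfl

theorem op_cups (n : ℕ) : D.op.cups n = MulOpposite.op (D.caps n) := by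
  induction n with
  | zero => rfl
  | succ n ih => rw [cups, ih, op_shift]; rfl

theorem hom_caps (n : ℕ) : D.Hom 0 (2 * n) (D.caps n) := by
  induction n with
  | zero => exact .one _
  | succ n ih =>
    refine (Hom.cap 0 0 le_rfl).mul ?_
    have := (ih.shift 1).right 1
    rwa [show 1 + 2 * n + 1 = 2 * (n + 1) by ring] at this

theorem hom_cups (n : ℕ) : D.Hom (2 * n) 0 (D.cups n) := by
  induction n with
  | zero => exact .one _
  | succ n ih =>
    refine Hom.mul ?_ (Hom.cup 0 0 le_rfl)
    have := (ih.shift 1).right 1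
    rwa [show 1 + 2 * n + 1 = 2 * (n + 1) by ring] at this

theorem caps_succ (n : ℕ) : D.caps (n + 1) = D.caps n * D.cap n := by
  induction n with
  | zero => simp [caps]
  | succ n ih =>
    nth_rw 2 [caps]
    rw [mul_assoc, Nat.add_comm n 1, ← D.shift_cap, ← map_mul, ← ih, Nat.add_comm 1 n, caps]

theorem cups_succ (n : ℕ) : D.cups (n + 1) = D.cup n * D.cups n := by
  have := D.op.caps_succ n
  rw [op_caps, op_caps] at this
  exact MulOpposite.op_injective this

/-- The cabled zigzag: the innermost cap and cup meet first and straighten, and the rest is the case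
of one strand less. -/
theorem shift_caps_mul_cups (n : ℕ) : D.shift n (D.caps n) * D.cups n = 1 := by
  induction n with
  | zero => simp [caps, cups]
  | succ n ih =>
    rw [caps, cups_succ, map_mul, D.shift_shift, D.shift_cap, mul_assoc,
      ← mul_assoc (D.shift _ _) (D.cup n), show n + 1 + 1 = n + 2 by rfl, ← D.cup_mul_shift,
      mul_assoc, ih, mul_one]
    exact D.cap_succ_cup n

theorem caps_mul_shift_cups (n : ℕ) : D.caps n * D.shift n (D.cups n) = 1 := by
  have := D.op.shift_caps_mul_cups n
  rw [op_caps, op_cups, op_shift, ← op_mul] at this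
  exact MulOpposite.op_injective this

/-- A hook on one family of legs slides over the nested caps to the mirror position on the other.
Peeling off outer caps reduces to a hook on the two outermost strands, where both sides straighten
to two adjacent caps. -/
theorem caps_mul_hook {n i : ℕ} (h : i + 2 ≤ n) :
    D.caps n * D.hook i = D.caps n * D.hook (2 * n - 2 - i) := by
  induction n generalizing i with
  | zero => omega
  | succ n ih =>
    cases i with
    | succ i =>
      have := congrArg (D.shift 1) (ih (i := i) (by omega))
      rw [map_mul, map_mul, shift_hook, shift_hook] at this
      rw [caps, mul_assoc, mul_assoc, Nat.add_comm i 1, this]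
      congr 3
      omega
    | zero =>
      obtain ⟨n, rfl⟩ := Nat.exists_eq_add_of_le' (show 1 ≤ n by omega)
      have h1 : D.shift 2 (D.caps n) * D.hook 0 = D.hook 0 * D.shift 2 (D.caps n) := by
        exact ((D.hom_hook (i := 0) (k := 2) le_rfl).comm _).symm
      have h2 : D.shift 2 (D.caps n) * D.hook (2 * (n + 1 + 1) - 2 - 0) =
          D.hook 2 * D.shift 2 (D.caps n) := by
        have := congrArg (D.shift 2) ((D.hom_caps n).comm (D.hook 0))
        rw [map_mul, map_mul, shift_hook, shift_hook, shift_hook] at this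
        rw [show 2 * (n + 1 + 1) - 2 - 0 = 2 + (2 * n + 0) by omega, this, shift_hook]
      have h3 : D.cap 0 * (D.cap 1 * D.hook 0) = D.cap 0 * (D.cap 1 * D.hook 2) := by
        rw [hook, hook, ← mul_assoc (D.cap 1), ← mul_assoc (D.cap 1)]
        rw [D.cap_succ_cup 0, D.cap_cup_succ 1, one_mul, one_mul]
        exact (D.cap_cap_far 0 0).symm
      rw [caps, caps, map_mul, D.shift_cap, D.shift_shift, mul_assoc, mul_assoc, mul_assoc,
        mul_assoc, h1, h2]
      simpa only [mul_assoc] using congrArg (· * D.shift 2 (D.caps n)) h3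

theorem mul_jonesWenzl_eq_zero {n : ℕ} {x : B}
    (hx : x ∈ NonUnitalAlgebra.adjoin K {x | ∃ i, i + 2 ≤ n ∧ x = D.hook i}) :
    x * D.jonesWenzl n = 0 := by
  induction hx using NonUnitalAlgebra.adjoin_induction with
  | mem x hx => obtain ⟨i, hi, rfl⟩ := hx; exact D.hook_mul_jonesWenzl hi
  | add x y _ _ hx hy => rw [add_mul, hx, hy, add_zero]
  | zero => rw [zero_mul]
  | mul x y _ _ _ hy => rw [mul_assoc, hy, mul_zero]
  | smul c x _ hx => rw [smul_mul_assoc, hx, smul_zero]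

theorem hom_of_mem_adjoin {n : ℕ} {x : B}
    (hx : x ∈ NonUnitalAlgebra.adjoin K {x | ∃ i, i + 2 ≤ n ∧ x = D.hook i}) :
    D.Hom n n x := by
  induction hx using NonUnitalAlgebra.adjoin_induction with
  | mem x hx => obtain ⟨i, hi, rfl⟩ := hx; exact D.hom_hook hi
  | add x y _ _ hx hy => exact hx.add hy
  | zero => simpa using (Hom.one (D := D) n).smul 0
  | mul x y _ _ hx hy => exact hx.mul hy
  | smul c x _ hx => exact hx.smul c

/-- Sliding over nested caps reverses products. What matters is that the result again lies in the
nonunital algebra of hooks, hence is annihilated by the projector; its exact form is irrelevant, so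
mirror symmetry of `f⁽ⁿ⁾` is not needed. -/
theorem caps_mul_of_mem_adjoin {n : ℕ} {x : B}
    (hx : x ∈ NonUnitalAlgebra.adjoin K {x | ∃ i, i + 2 ≤ n ∧ x = D.hook i}) :
    (∃ y ∈ NonUnitalAlgebra.adjoin K {x | ∃ i, i + 2 ≤ n ∧ x = D.hook i},
      D.caps n * x = D.caps n * D.shift n y) ∧
    ∃ y ∈ NonUnitalAlgebra.adjoin K {x | ∃ i, i + 2 ≤ n ∧ x = D.hook i},
      D.caps n * D.shift n x = D.caps n * y := by
  induction hx using NonUnitalAlgebra.adjoin_induction with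
  | mem x hx =>
    obtain ⟨i, hi, rfl⟩ := hx
    have hmem : D.hook (n - 2 - i) ∈
        NonUnitalAlgebra.adjoin K {x | ∃ i, i + 2 ≤ n ∧ x = D.hook i} :=
      NonUnitalAlgebra.subset_adjoin K ⟨n - 2 - i, by omega, rfl⟩
    refine ⟨⟨_, hmem, ?_⟩, ⟨_, hmem, ?_⟩⟩
    · rw [shift_hook, D.caps_mul_hook hi]
      congr 2
      omega
    · rw [shift_hook, D.caps_mul_hook (i := n - 2 - i) (by omega)]
      congr 2
      omega
  | add x y _ _ hx hy =>
    obtain ⟨⟨x1, h1, e1⟩, x2, h2, e2⟩ := hx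
    obtain ⟨⟨y1, g1, d1⟩, y2, g2, d2⟩ := hy
    exact ⟨⟨_, add_mem h1 g1, by rw [mul_add, e1, d1, map_add, mul_add]⟩,
      ⟨_, add_mem h2 g2, by rw [map_add, mul_add, e2, d2, mul_add]⟩⟩
  | zero => exact ⟨⟨0, zero_mem _, by simp⟩, 0, zero_mem _, by simp⟩
  | mul x y hx0 hy0 hx hy =>
    obtain ⟨⟨x1, h1, e1⟩, x2, h2, e2⟩ := hx
    obtain ⟨⟨y1, g1, d1⟩, y2, g2, d2⟩ := hy
    refine ⟨⟨_, mul_mem g1 h1, ?_⟩, ⟨_, mul_mem g2 h2, ?_⟩⟩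
    · rw [← mul_assoc, e1, mul_assoc, ← (D.hom_of_mem_adjoin hy0).comm, ← mul_assoc, d1, map_mul,
        mul_assoc]
    · rw [map_mul, ← mul_assoc, e2, mul_assoc, (D.hom_of_mem_adjoin h2).comm, ← mul_assoc, d2,
        mul_assoc]
  | smul c x _ hx =>
    obtain ⟨⟨x1, h1, e1⟩, x2, h2, e2⟩ := hx
    exact ⟨⟨_, SMulMemClass.smul_mem c h1, by rw [mul_smul_comm, e1, map_smul, mul_smul_comm]⟩,
      ⟨_, SMulMemClass.smul_mem c h2, by rw [map_smul, mul_smul_comm, e2, mul_smul_comm]⟩⟩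

/-- The projector slides over nested caps. -/
theorem caps_mul_jonesWenzl (n : ℕ) :
    D.caps n * D.jonesWenzl n = D.caps n * D.shift n (D.jonesWenzl n) := by
  obtain ⟨⟨y, hy, ey⟩, z, hz, ez⟩ := D.caps_mul_of_mem_adjoin (D.jonesWenzl_sub_one_mem n)
  have hfc := (D.hom_jonesWenzl n).comm (D.jonesWenzl n)
  have hy0 := D.mul_jonesWenzl_eq_zero hy
  have hz0 := D.mul_jonesWenzl_eq_zero hz
  set f := D.jonesWenzl n with hf
  have h1 : D.caps n * f = D.caps n + D.caps n * D.shift n y := by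
    rw [← ey, mul_sub, mul_one]; abel
  have h2 : D.caps n * D.shift n f = D.caps n + D.caps n * z := by
    rw [← ez, map_sub, map_one, mul_sub, mul_one]; abel
  -- With a projector on both legs, each one absorbs the correction term coming from the other. So
  -- the doubly decorated caps equal both singly decorated ones.
  have h3 : D.caps n * f * D.shift n f = D.caps n * D.shift n f := by
    rw [h1, add_mul, mul_assoc, ← map_mul, hy0, map_zero, mul_zero, add_zero]
  have h4 : D.caps n * D.shift n f * f = D.caps n * f := by
    rw [h2, add_mul, mul_assoc, hz0, mul_zero, add_zero]
  rw [← h3, mul_assoc, hfc, ← mul_assoc, h4]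

/-- The projector slides over nested cups. -/
theorem jonesWenzl_mul_cups (n : ℕ) :
    D.jonesWenzl n * D.cups n = D.shift n (D.jonesWenzl n) * D.cups n := by
  have := D.op.caps_mul_jonesWenzl n
  rw [op_caps, op_jonesWenzl, op_shift] at this
  exact MulOpposite.op_injective this

/-! ### Curls of bundles of strands -/

/-- Naturality says that nested caps pass through a bundle of `n` strands. The bundle crosses both
families of legs; undoing one of the two crossings gives the cabled slide move. -/
theorem shift_caps_mul_braid (b : Bool) (n : ℕ) :
    D.shift n (D.caps n) * D.braid b n n = D.caps n * D.shift n (D.braid (!b) n n) := by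
  have h := (D.hom_caps n).mul_braid (!b) n
  have h2 := D.braid_mul_braid_not (!b) n n
  rw [Bool.not_not] at h2
  rw [two_mul, braid_add_left, braid_zero_left, one_mul] at h
  rw [← h, mul_assoc, mul_assoc, h2, mul_one]

theorem braid_mul_shift_cups (b : Bool) (n : ℕ) :
    D.braid b n n * D.shift n (D.cups n) = D.shift n (D.braid (!b) n n) * D.cups n := by
  have h := (D.hom_cups n).mul_braid b n
  have h2 := congrArg (D.shift n) (D.braid_mul_braid_not (!b) n n)
  rw [Bool.not_not, map_mul, map_one] at h2
  rw [two_mul, braid_add_left, braid_zero_left, mul_one] at h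
  nth_rw 2 [h]
  rw [mul_assoc, mul_mul_of_mul_eq h2, one_mul]

/-- `n` parallel strands with a curl on the right. -/
noncomputable def curlRight (b : Bool) (n : ℕ) : B :=
  D.shift n (D.caps n) * D.braid b n n * D.shift n (D.cups n)

/-- `n` parallel strands with a curl on the left. -/
noncomputable def curlLeft (b : Bool) (n : ℕ) : B :=
  D.caps n * D.shift n (D.braid b n n) * D.cups n

theorem hom_caps_right (n k : ℕ) : D.Hom k (2 * n + k) (D.caps n) := by
  simpa using (D.hom_caps n).right k

theorem hom_cups_right (n k : ℕ) : D.Hom (2 * n + k) k (D.cups n) := by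
  simpa using (D.hom_cups n).right k

theorem hom_curlRight (b : Bool) (n : ℕ) : D.Hom n n (D.curlRight b n) := by
  have h1 := (D.hom_caps n).shift n
  have h2 := (D.hom_braid b n n).right n
  have h3 := (D.hom_cups n).shift n
  rw [show n + n + n = n + 2 * n by ring] at h2
  exact (h1.mul h2).mul h3

theorem hom_curlLeft (b : Bool) (n : ℕ) : D.Hom n n (D.curlLeft b n) := by
  have h1 := D.hom_caps_right n n
  have h2 := (D.hom_braid b n n).shift n
  have h3 := D.hom_cups_right n n
  rw [show n + (n + n) = 2 * n + n by ring] at h2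
  exact (h1.mul h2).mul h3

/-- After the slide move the caps of the curl straighten against the outer cups. So a curl on one
leg of nested cups is a crossing of the two legs. -/
theorem shift_curlRight_mul_cups (b : Bool) (n : ℕ) :
    D.shift n (D.curlRight b n) * D.cups n = D.braid (!b) n n * D.cups n := by
  have h := (D.hom_cups n).comm (D.braid (!b) n n * D.cups n)
  rw [D.shift_zero] at h
  rw [curlRight, shift_caps_mul_braid, mul_assoc, ← map_mul, map_mul, D.shift_shift, mul_assoc,
    ← two_mul, ← h, ← mul_assoc, shift_caps_mul_cups, one_mul]

theorem curlLeft_mul_cups (b : Bool) (n : ℕ) :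
    D.curlLeft b n * D.cups n = D.braid (!b) n n * D.cups n := by
  have h := (D.hom_cups n).comm (D.cups n)
  have h' := ((D.hom_braid (!b) n n).comm (D.cups n))
  rw [D.shift_zero] at h
  rw [curlLeft, ← Bool.not_not b, ← shift_caps_mul_braid, Bool.not_not, mul_assoc, h, two_mul,
    mul_assoc, mul_mul_of_mul_eq h', mul_assoc, ← D.shift_shift, ← mul_assoc, ← map_mul,
    caps_mul_shift_cups, map_one, one_mul]

/-- Whitney trick: one curl turns into a crossing of the legs, the other slides through this
crossing to the other leg and turns into the inverse crossing. Reidemeister I is not used. -/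
theorem curlRight_mul_shift_curlRight (b : Bool) (n : ℕ) :
    D.curlRight b n * D.shift n (D.curlRight (!b) n) * D.cups n = D.cups n := by
  have h := (D.hom_curlRight b n).mul_braid b n
  rw [mul_assoc, shift_curlRight_mul_cups, Bool.not_not, ← mul_assoc, h, mul_assoc,
    shift_curlRight_mul_cups, ← mul_assoc, braid_mul_braid_not, one_mul]

theorem shift_curlLeft_mul_curlLeft (b : Bool) (n : ℕ) :
    D.shift n (D.curlLeft b n) * D.curlLeft (!b) n * D.cups n = D.cups n := by
  have h := (D.hom_curlLeft b n).shift_mul_braid b n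
  rw [mul_assoc, curlLeft_mul_cups, Bool.not_not, ← mul_assoc, h, mul_assoc,
    curlLeft_mul_cups, ← mul_assoc, braid_mul_braid_not, one_mul]

variable {D}

/-- One projector on the cups can be doubled so that both legs carry one; each then evaluates its
own factor to a scalar. Bending one leg back with caps turns the equation for `f * cups` into one
for `f`. -/
theorem mul_smul_jonesWenzl {n : ℕ} {x y : B} {c d : K} (hx : D.Hom n n x)
    (hxc : D.jonesWenzl n * x = c • D.jonesWenzl n)
    (hyd : D.jonesWenzl n * y = d • D.jonesWenzl n)
    (h : x * D.shift n y * D.cups n = D.cups n) :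
    (c * d) • D.jonesWenzl n = D.jonesWenzl n := by
  have hf := D.hom_jonesWenzl n
  have hff := D.jonesWenzl_mul_self n
  have hcups := D.jonesWenzl_mul_cups n
  set f := D.jonesWenzl n with hfdef
  have h1 : f * D.cups n = (c * d) • (f * D.cups n) := by
    calc f * D.cups n = f * D.shift n f * D.cups n := by
          rw [mul_assoc, ← hcups, ← mul_assoc, hff]
      _ = f * (D.shift n f * x) * D.shift n y * D.cups n := by
          nth_rw 1 [← h]; simp only [mul_assoc]
      _ = (f * x) * D.shift n (f * y) * D.cups n := by
          rw [← hx.comm, map_mul]; simp only [mul_assoc]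
      _ = (c * d) • (f * D.shift n f * D.cups n) := by
          rw [hxc, hyd, map_smul, smul_mul_assoc, mul_smul_comm, smul_smul, smul_mul_assoc]
      _ = _ := by rw [mul_assoc f, ← hcups, ← mul_assoc, hff]
  have h2 : D.shift n (D.caps n) * (f * D.cups n) = f := by
    rw [← mul_assoc, ← hf.comm, mul_assoc, shift_caps_mul_cups, mul_one]
  have h3 := congrArg (D.shift n (D.caps n) * ·) h1
  simp only [mul_smul_comm, h2] at h3
  exact h3.symm

variable (D)

theorem exists_jonesWenzl_mul {n : ℕ} {x y : B} (hx : D.Hom n n x) (hy : D.Hom n n y)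
    (h : x * D.shift n y * D.cups n = D.cups n ∨ D.shift n x * y * D.cups n = D.cups n) :
    ∃ c : K, c ≠ 0 ∧ D.jonesWenzl n * x = c • D.jonesWenzl n := by
  obtain ⟨c, hc⟩ := hx.jonesWenzl_mul
  obtain ⟨d, hd⟩ := hy.jonesWenzl_mul
  have hcd : (c * d) • D.jonesWenzl n = D.jonesWenzl n := by
    rcases h with h | h
    · exact mul_smul_jonesWenzl hx hc hd h
    · rw [← hy.comm] at h
      rw [mul_comm]
      exact mul_smul_jonesWenzl hy hd hc h
  by_cases h0 : c = 0
  -- If `c = 0`, then `c * d = 0` forces the projector itself to vanish, and every scalar serves.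
  -- Thus `jonesWenzl n ≠ 0` need not be known.
  · refine ⟨1, one_ne_zero, ?_⟩
    rw [h0, zero_mul, zero_smul] at hcd
    rw [← hcd, zero_mul, smul_zero]
  · exact ⟨c, h0, hc⟩

theorem exists_jonesWenzl_mul_curlRight (b : Bool) (n : ℕ) :
    ∃ c : K, c ≠ 0 ∧ D.jonesWenzl n * D.curlRight b n = c • D.jonesWenzl n :=
  D.exists_jonesWenzl_mul (D.hom_curlRight b n) (D.hom_curlRight (!b) n)
    (.inl (D.curlRight_mul_shift_curlRight b n))

theorem exists_jonesWenzl_mul_curlLeft (b : Bool) (n : ℕ) :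
    ∃ c : K, c ≠ 0 ∧ D.jonesWenzl n * D.curlLeft b n = c • D.jonesWenzl n :=
  D.exists_jonesWenzl_mul (D.hom_curlLeft b n) (D.hom_curlLeft (!b) n)
    (.inr (D.shift_curlLeft_mul_curlLeft b n))

/-! ### Colored words -/

/-- Projectors on `k` clusters of `n` strands. -/
noncomputable def projectors (n : ℕ) : ℕ → B
  | 0 => 1
  | k + 1 => projectors n k * D.shift (n * k) (D.jonesWenzl n)

theorem hom_projectors (n k : ℕ) : D.Hom (n * k) (n * k) (D.projectors n k) := by
  induction k with
  | zero => exact .one _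
  | succ k ih => exact (ih.right n).mul ((D.hom_jonesWenzl n).shift (n * k))

theorem projectors_one (n : ℕ) : D.projectors n 1 = D.jonesWenzl n := by
  simp [projectors, D.shift_zero]

theorem projectors_add (n a k : ℕ) :
    D.projectors n (a + k) = D.projectors n a * D.shift (n * a) (D.projectors n k) := by
  induction k with
  | zero => simp [projectors]
  | succ k ih =>
    rw [← Nat.add_assoc, projectors, ih, projectors, map_mul, D.shift_shift, mul_assoc, mul_add]

theorem projectors_mul_self (n k : ℕ) :
    D.projectors n k * D.projectors n k = D.projectors n k := by
  induction k with
  | zero => exact one_mul 1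
  | succ k ih =>
    rw [projectors]
    nth_rw 2 [(D.hom_projectors n k).comm]
    rw [mul_assoc, ← mul_assoc (D.shift _ _), ← map_mul, jonesWenzl_mul_self,
      ← (D.hom_projectors n k).comm, ← mul_assoc, ih]

/-- The `n`-th parallel of an elementary piece. -/
noncomputable def cable (n : ℕ) : Elem → B
  | .cap => D.caps n
  | .cup => D.cups n
  | .cross b => D.braid b n n

theorem hom_cable (n : ℕ) (e : Elem) : D.Hom (n * e.top) (n * e.bot) (D.cable n e) := by
  cases e with
  | cap => rw [Elem.bot, mul_comm n 2]; exact D.hom_caps n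
  | cup => rw [Elem.top, mul_comm n 2]; exact D.hom_cups n
  | cross b => rw [Elem.bot, Elem.top, mul_two]; exact D.hom_braid b n n

/-- The `n`-th parallel of a word of slices, with projectors inserted between the slices. -/
noncomputable def colored (n : ℕ) : ℕ → List Slice → B
  | k, [] => D.projectors n k
  | k, s :: w => D.projectors n k * D.shift (n * s.pos) (D.cable n s.elem) *
      colored n (k - s.elem.top + s.elem.bot) w

theorem hom_shift_cable (n : ℕ) (s : Slice) {k : ℕ} (h : s.pos + s.elem.top ≤ k) :
    D.Hom (n * k) (n * (k - s.elem.top + s.elem.bot))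
      (D.shift (n * s.pos) (D.cable n s.elem)) := by
  obtain ⟨r, rfl⟩ := Nat.exists_eq_add_of_le h
  have := ((D.hom_cable n s.elem).shift (n * s.pos)).right (n * r)
  rw [show s.pos + s.elem.top + r - s.elem.top + s.elem.bot = s.pos + s.elem.bot + r by omega]
  simpa only [mul_add] using this

theorem hom_colored (n : ℕ) {k l : ℕ} {w : List Slice} (h : IsDiag w k l) :
    D.Hom (n * k) (n * l) (D.colored n k w) := by
  induction w generalizing k with
  | nil => obtain rfl : k = l := h; exact D.hom_projectors n k
  | cons s w ih => exact ((D.hom_projectors n k).mul (D.hom_shift_cable n s h.1)).mul (ih h.2)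

theorem projectors_mul_colored (n k : ℕ) (w : List Slice) :
    D.projectors n k * D.colored n k w = D.colored n k w := by
  cases w with
  | nil => exact D.projectors_mul_self n k
  | cons s w => rw [colored, ← mul_assoc, ← mul_assoc, projectors_mul_self]

theorem colored_mul_projectors (n : ℕ) {k l : ℕ} {w : List Slice} (h : IsDiag w k l) :
    D.colored n k w * D.projectors n l = D.colored n k w := by
  induction w generalizing k with
  | nil => obtain rfl : k = l := h; exact D.projectors_mul_self n k
  | cons s w ih => rw [colored, mul_assoc, ih h.2]

/-- At the seam the projectors occur twice on the right-hand side; idempotence makes this harmless.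
-/
theorem colored_append (n : ℕ) {k l : ℕ} {u : List Slice} (v : List Slice) (h : IsDiag u k l) :
    D.colored n k (u ++ v) = D.colored n k u * D.colored n l v := by
  induction u generalizing k with
  | nil => obtain rfl : k = l := h; exact (D.projectors_mul_colored n k v).symm
  | cons s u ih => rw [List.cons_append, colored, ih h.2, colored, mul_assoc, mul_assoc, mul_assoc]

/-- The idle clusters carry a projector at every level. These commute with everything to their right
and collapse to one. -/
theorem colored_shift (n a : ℕ) {k l : ℕ} {w : List Slice} (h : IsDiag w k l) :
    D.colored n (a + k) (w.map (Slice.shift a)) =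
      D.projectors n a * D.shift (n * a) (D.colored n k w) := by
  induction w generalizing k with
  | nil => exact D.projectors_add n a k
  | cons s w ih =>
    have hc := (D.hom_projectors n a).comm
    have h1 := h.1
    rw [List.map_cons, colored, colored]
    simp only [Slice.shift]
    rw [show a + k - s.elem.top + s.elem.bot = a + (k - s.elem.top + s.elem.bot) by omega,
      ih h.2, projectors_add, map_mul, map_mul, D.shift_shift, mul_add]
    rw [← D.shift_shift]
    calc _ = D.projectors n a * D.shift (n * a) (D.projectors n k *
            D.shift (n * s.pos) (D.cable n s.elem)) * D.projectors n a *
            D.shift (n * a) (D.colored n (k - s.elem.top + s.elem.bot) w) := by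
          simp only [map_mul, mul_assoc]
      _ = D.projectors n a * D.projectors n a * D.shift (n * a) (D.projectors n k *
            D.shift (n * s.pos) (D.cable n s.elem)) *
            D.shift (n * a) (D.colored n (k - s.elem.top + s.elem.bot) w) := by
          rw [mul_assoc (D.projectors n a) (D.shift _ _) (D.projectors n a), ← hc, ← mul_assoc]
      _ = _ := by rw [projectors_mul_self]; simp only [map_mul, mul_assoc]

theorem colored_right (n r : ℕ) {k l : ℕ} {w : List Slice} (h : IsDiag w k l) :
    D.colored n (k + r) w = D.colored n k w * D.shift (n * l) (D.projectors n r) := by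
  induction w generalizing k with
  | nil => obtain rfl : k = l := h; exact D.projectors_add n k r
  | cons s w ih =>
    have h1 := h.1
    have hc := (D.hom_shift_cable n s h.1).comm (D.projectors n r)
    have hw := (D.hom_colored n h.2).comm (D.projectors n r)
    rw [colored, colored,
      show k + r - s.elem.top + s.elem.bot = k - s.elem.top + s.elem.bot + r by omega, ih h.2,
      projectors_add]
    calc _ = D.projectors n k * (D.shift (n * k) (D.projectors n r) *
            D.shift (n * s.pos) (D.cable n s.elem)) *
            (D.colored n (k - s.elem.top + s.elem.bot) w * D.shift (n * l) (D.projectors n r)) := by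
          simp only [mul_assoc]
      _ = D.projectors n k * D.shift (n * s.pos) (D.cable n s.elem) *
            D.colored n (k - s.elem.top + s.elem.bot) w *
              D.shift (n * l) (D.projectors n r * D.projectors n r) := by
          rw [← hc, hw, map_mul]
          simp only [mul_assoc]
          rw [mul_mul_of_mul_eq hw, mul_assoc (D.shift _ _), hw]
      _ = _ := by rw [projectors_mul_self]

/-- Relations between colored words hold in all positions. -/
theorem colored_shift_right {n k l : ℕ} {u v : List Slice} {c : K} (hu : IsDiag u k l)
    (hv : IsDiag v k l) (h : D.colored n k u = c • D.colored n k v) (a r : ℕ) :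
    D.colored n (a + k + r) (u.map (Slice.shift a)) =
      c • D.colored n (a + k + r) (v.map (Slice.shift a)) := by
  rw [D.colored_right n r (hu.addLeft a), D.colored_right n r (hv.addLeft a),
    D.colored_shift n a hu, D.colored_shift n a hv, h]
  simp

/-! ### Projectors and elementary pieces -/

theorem projectors_two (n : ℕ) :
    D.projectors n 2 = D.jonesWenzl n * D.shift n (D.jonesWenzl n) := by
  rw [projectors, projectors_one, mul_one]

theorem projectors_three (n : ℕ) :
    D.projectors n 3 = D.projectors n 2 * D.shift (2 * n) (D.jonesWenzl n) := by
  rw [projectors, mul_comm n 2]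

theorem projectors_three' (n : ℕ) :
    D.projectors n 3 = D.jonesWenzl n * D.shift n (D.projectors n 2) := by
  have := D.projectors_add n 1 2
  rwa [projectors_one, mul_one] at this

theorem jonesWenzl_comm (n : ℕ) (y : B) :
    D.jonesWenzl n * D.shift n y = D.shift n y * D.jonesWenzl n :=
  (D.hom_jonesWenzl n).comm y

theorem jonesWenzl_mul_braid (b : Bool) (n : ℕ) :
    D.jonesWenzl n * D.braid b n n = D.braid b n n * D.shift n (D.jonesWenzl n) :=
  (D.hom_jonesWenzl n).mul_braid b n

theorem shift_jonesWenzl_mul_braid (b : Bool) (n : ℕ) :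
    D.shift n (D.jonesWenzl n) * D.braid b n n = D.braid b n n * D.jonesWenzl n :=
  (D.hom_jonesWenzl n).shift_mul_braid b n

theorem caps_mul_shift (n : ℕ) (y : B) : D.caps n * D.shift (2 * n) y = y * D.caps n := by
  rw [(D.hom_caps n).comm, D.shift_zero]

theorem shift_mul_cups (n : ℕ) (y : B) : D.shift (2 * n) y * D.cups n = D.cups n * y := by
  rw [← (D.hom_cups n).comm, D.shift_zero]

theorem projectors_two_mul_braid (b : Bool) (n : ℕ) :
    D.projectors n 2 * D.braid b n n = D.braid b n n * D.projectors n 2 := by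
  rw [projectors_two, mul_assoc, shift_jonesWenzl_mul_braid, ← mul_assoc, jonesWenzl_mul_braid,
    mul_assoc, jonesWenzl_comm]

theorem projectors_two_mul_cups (n : ℕ) :
    D.projectors n 2 * D.cups n = D.jonesWenzl n * D.cups n := by
  rw [projectors_two, mul_assoc, ← jonesWenzl_mul_cups, ← mul_assoc, jonesWenzl_mul_self]

theorem caps_mul_projectors_two (n : ℕ) :
    D.caps n * D.projectors n 2 = D.caps n * D.jonesWenzl n := by
  rw [projectors_two, jonesWenzl_comm, ← mul_assoc, ← caps_mul_jonesWenzl, mul_assoc,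
    jonesWenzl_mul_self]

theorem projectors_three_mul_braid (b : Bool) (n : ℕ) :
    D.projectors n 3 * D.braid b n n = D.braid b n n * D.projectors n 3 := by
  have h := (D.hom_braid b n n).comm (D.jonesWenzl n)
  rw [← two_mul] at h
  rw [projectors_three, mul_assoc, ← h, ← mul_assoc, projectors_two_mul_braid, mul_assoc]

theorem projectors_three_mul_shift_braid (b : Bool) (n : ℕ) :
    D.projectors n 3 * D.shift n (D.braid b n n) =
      D.shift n (D.braid b n n) * D.projectors n 3 := by
  rw [projectors_three', mul_assoc, ← map_mul, projectors_two_mul_braid, map_mul, ← mul_assoc,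
    jonesWenzl_comm, mul_assoc]

theorem projectors_three_mul_cups (n : ℕ) :
    D.projectors n 3 * D.cups n = D.jonesWenzl n * D.cups n * D.jonesWenzl n := by
  rw [projectors_three, mul_assoc, shift_mul_cups, ← mul_assoc, projectors_two_mul_cups]

theorem projectors_three_mul_shift_cups (n : ℕ) :
    D.projectors n 3 * D.shift n (D.cups n) =
      D.shift n (D.jonesWenzl n * D.cups n) * D.jonesWenzl n := by
  rw [projectors_three', mul_assoc, ← map_mul, projectors_two_mul_cups, jonesWenzl_comm]

theorem caps_mul_projectors_three (n : ℕ) :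
    D.caps n * D.projectors n 3 = D.jonesWenzl n * (D.caps n * D.jonesWenzl n) := by
  have h := (D.hom_projectors n 2).comm (D.jonesWenzl n)
  rw [mul_comm n 2] at h
  rw [projectors_three, h, ← mul_assoc, caps_mul_shift, mul_assoc, caps_mul_projectors_two]

theorem shift_caps_mul_projectors_three (n : ℕ) :
    D.shift n (D.caps n) * D.projectors n 3 =
      D.jonesWenzl n * D.shift n (D.caps n * D.jonesWenzl n) := by
  rw [projectors_three', ← mul_assoc, ← jonesWenzl_comm, mul_assoc, ← map_mul,
    caps_mul_projectors_two]

/-! ### Isotopy invariance of colored words -/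

/-- The projectors on the bent strand slide to its ends, leaving the bare cabled zigzag, which
straightens. The other moves below follow the same pattern. -/
theorem colored_zigzag_right (n : ℕ) :
    D.colored n 1 [TangleSkein.cap 1, TangleSkein.cup 0] = D.colored n 1 [] := by
  simp only [colored, cable, Elem.top, Elem.bot, projectors_one, mul_zero, mul_one, D.shift_zero,
    Nat.sub_zero, Nat.reduceAdd, Nat.reduceSub]
  rw [projectors_three_mul_cups]
  simp only [mul_assoc]
  rw [mul_mul_of_mul_eq (D.jonesWenzl_comm n _).symm, mul_assoc,
    mul_mul_of_mul_eq (D.shift_caps_mul_cups n), one_mul]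
  simp only [D.jonesWenzl_mul_self]

theorem colored_zigzag_left (n : ℕ) :
    D.colored n 1 [TangleSkein.cap 0, TangleSkein.cup 1] = D.colored n 1 [] := by
  simp only [colored, cable, Elem.top, Elem.bot, projectors_one, mul_zero, mul_one, D.shift_zero,
    Nat.sub_zero, Nat.reduceAdd, Nat.reduceSub]
  rw [mul_assoc, ← mul_assoc (D.caps n), ← mul_assoc (D.caps n), caps_mul_projectors_three]
  simp only [mul_assoc]
  rw [mul_mul_of_mul_eq (D.jonesWenzl_comm n _), mul_assoc,
    mul_mul_of_mul_eq (D.caps_mul_shift_cups n), one_mul]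
  simp only [D.jonesWenzl_mul_self]

theorem colored_slide_cap (b : Bool) (n : ℕ) :
    D.colored n 1 [TangleSkein.cap 1, TangleSkein.cross b 0] =
      D.colored n 1 [TangleSkein.cap 0, TangleSkein.cross (!b) 1] := by
  simp only [colored, cable, Elem.top, Elem.bot, projectors_one, mul_zero, mul_one, D.shift_zero,
    Nat.sub_zero, Nat.reduceAdd, Nat.reduceSub]
  rw [projectors_three_mul_braid, projectors_three_mul_shift_braid]
  simp only [mul_assoc, projectors_mul_self]
  rw [mul_mul_of_mul_eq (D.shift_caps_mul_braid b n)]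
  simp only [mul_assoc]

theorem colored_slide_cup (b : Bool) (n : ℕ) :
    D.colored n 3 [TangleSkein.cross b 0, TangleSkein.cup 1] =
      D.colored n 3 [TangleSkein.cross (!b) 1, TangleSkein.cup 0] := by
  simp only [colored, cable, Elem.top, Elem.bot, projectors_one, mul_zero, mul_one, D.shift_zero,
    Nat.reduceAdd, Nat.reduceSub]
  simp only [mul_assoc]
  rw [mul_mul_of_mul_eq (D.projectors_three_mul_braid b n).symm,
    mul_mul_of_mul_eq (D.projectors_three_mul_shift_braid (!b) n).symm, mul_assoc, mul_assoc,
    mul_mul_of_mul_eq (D.braid_mul_shift_cups b n)]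
  simp only [mul_assoc]

theorem colored_reidemeister_two (b : Bool) (n : ℕ) :
    D.colored n 2 [TangleSkein.cross b 0, TangleSkein.cross (!b) 0] = D.colored n 2 [] := by
  simp only [colored, cable, Elem.top, Elem.bot, mul_zero, D.shift_zero, Nat.reduceAdd,
    Nat.reduceSub]
  simp only [mul_assoc]
  rw [mul_mul_of_mul_eq (D.projectors_two_mul_braid b n).symm, mul_assoc,
    mul_mul_of_mul_eq (D.braid_mul_braid_not b n n), one_mul]
  simp only [projectors_mul_self]

/-- Reidemeister III for cables is naturality of the braiding, applied to a braiding itself. -/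
theorem braid_braid_braid (b : Bool) (n : ℕ) :
    D.braid b n n * (D.shift n (D.braid b n n) * D.braid b n n) =
      D.shift n (D.braid b n n) * (D.braid b n n * D.shift n (D.braid b n n)) := by
  have := (D.hom_braid b n n).shift_mul_braid b n
  rw [braid_add_right] at this
  rw [this, mul_assoc]

theorem colored_reidemeister_three (b : Bool) (n : ℕ) :
    D.colored n 3 [TangleSkein.cross b 0, TangleSkein.cross b 1, TangleSkein.cross b 0] =
      D.colored n 3 [TangleSkein.cross b 1, TangleSkein.cross b 0, TangleSkein.cross b 1] := by
  simp only [colored, cable, Elem.top, Elem.bot, mul_zero, mul_one, D.shift_zero, Nat.reduceAdd,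
    Nat.reduceSub]
  simp only [mul_assoc, projectors_three_mul_braid, projectors_three_mul_shift_braid,
    mul_mul_of_mul_eq (D.projectors_three_mul_braid b n),
    mul_mul_of_mul_eq (D.projectors_three_mul_shift_braid b n), projectors_mul_self]
  have h := congrArg (· * D.projectors n 3) (D.braid_braid_braid b n)
  simpa only [mul_assoc] using h

/-- All inserted projectors lie on one strand, so they can be moved to its ends. The curl is then a
bare endomorphism next to `f⁽ⁿ⁾`, to which the scalar lemma applies. -/
theorem colored_curlRight (b : Bool) (n : ℕ) :
    D.colored n 1 (TangleSkein.curlRight b 0) =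
      D.jonesWenzl n * D.curlRight b n * D.jonesWenzl n := by
  simp only [TangleSkein.curlRight, colored, cable, Elem.top, Elem.bot, projectors_one, mul_zero,
    mul_one, D.shift_zero, Nat.sub_zero, Nat.reduceAdd, Nat.reduceSub]
  set f := D.jonesWenzl n with hf
  have hff : f * f = f := D.jonesWenzl_mul_self n
  have hfc : ∀ y, f * D.shift n y = D.shift n y * f := D.jonesWenzl_comm n
  have h1 : f * D.shift n (D.caps n) * D.projectors n 3 =
      f * (D.shift n (D.caps n) * D.shift n f) := by
    rw [mul_assoc, shift_caps_mul_projectors_three, ← hf, ← mul_assoc, hff, map_mul]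
  have h2 : D.projectors n 3 * (D.shift n (D.cups n) * f) =
      D.shift n f * (D.shift n (D.cups n) * f) := by
    rw [← mul_assoc, projectors_three_mul_shift_cups, ← hf, mul_assoc, hff, map_mul, mul_assoc]
  have h3 : D.shift n f * (D.braid b n n * D.shift n f) = f * (D.braid b n n * f) := by
    rw [← D.jonesWenzl_mul_braid, ← mul_assoc, ← hf, ← hfc, mul_assoc,
      D.shift_jonesWenzl_mul_braid]
  calc _ = f * D.shift n (D.caps n) * D.projectors n 3 * (D.braid b n n *
        (D.projectors n 3 * (D.shift n (D.cups n) * f))) := by simp only [mul_assoc]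
    _ = f * D.shift n (D.caps n) * (D.shift n f * (D.braid b n n * D.shift n f)) *
        D.shift n (D.cups n) * f := by rw [h1, h2]; simp only [mul_assoc]
    _ = f * (D.shift n (D.caps n) * f) * D.braid b n n * (f * D.shift n (D.cups n)) * f := by
      rw [h3]; simp only [mul_assoc]
    _ = f * (f * D.shift n (D.caps n)) * D.braid b n n * (f * D.shift n (D.cups n)) * f := by
      rw [hfc (D.caps n)]
    _ = (f * f) * D.shift n (D.caps n) * D.braid b n n * D.shift n (D.cups n) * (f * f) := by
      rw [hfc (D.cups n)]; simp only [mul_assoc]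
    _ = _ := by rw [hff, curlRight]; simp only [mul_assoc]

theorem colored_curlLeft (b : Bool) (n : ℕ) :
    D.colored n 1 (TangleSkein.curlLeft b 0) =
      D.jonesWenzl n * D.curlLeft b n * D.jonesWenzl n := by
  simp only [TangleSkein.curlLeft, colored, cable, Elem.top, Elem.bot, projectors_one, mul_zero,
    mul_one, D.shift_zero, Nat.sub_zero, Nat.reduceAdd, Nat.reduceSub]
  set f := D.jonesWenzl n with hf
  have hff : f * f = f := D.jonesWenzl_mul_self n
  have hfc : ∀ y, f * D.shift n y = D.shift n y * f := D.jonesWenzl_comm n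
  have h1 : f * D.caps n * D.projectors n 3 = f * (D.caps n * f) := by
    rw [mul_assoc, caps_mul_projectors_three, ← hf, ← mul_assoc, hff]
  have h2 : D.projectors n 3 * (D.cups n * f) = f * (D.cups n * f) := by
    rw [← mul_assoc, projectors_three_mul_cups, ← hf, mul_assoc, hff, mul_assoc]
  have h3 : D.shift n (D.braid b n n) * D.shift n f =
      D.shift (2 * n) f * D.shift n (D.braid b n n) := by
    rw [two_mul, ← D.shift_shift, ← map_mul, ← map_mul, hf, D.shift_jonesWenzl_mul_braid]
  calc _ = f * D.caps n * D.projectors n 3 * (D.shift n (D.braid b n n) *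
        (D.projectors n 3 * (D.cups n * f))) := by simp only [mul_assoc]
    _ = f * D.caps n * (f * D.shift n (D.braid b n n)) * f * D.cups n * f := by
      rw [h1, h2]; simp only [mul_assoc]
    _ = f * D.caps n * D.shift n (D.braid b n n) * (f * f) * D.cups n * f := by
      rw [hfc]; simp only [mul_assoc]
    _ = f * D.caps n * D.shift n (D.braid b n n) * (f * D.cups n) * f := by
      rw [hff]; simp only [mul_assoc]
    _ = f * D.caps n * (D.shift n (D.braid b n n) * D.shift n f) * D.cups n * f := by
      rw [hf, D.jonesWenzl_mul_cups]; simp only [mul_assoc]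
    _ = f * (D.caps n * D.shift (2 * n) f) * D.shift n (D.braid b n n) * D.cups n * f := by
      rw [h3]; simp only [mul_assoc]
    _ = (f * f) * D.caps n * D.shift n (D.braid b n n) * D.cups n * f := by
      rw [D.caps_mul_shift]; simp only [mul_assoc]
    _ = _ := by rw [hff, curlLeft]; simp only [mul_assoc]

theorem isDiag_singleton (e : Elem) (i r : ℕ) :
    IsDiag [⟨e, i⟩] (i + e.top + r) (i + e.bot + r) :=
  ⟨by dsimp only; omega, show _ = _ by dsimp only; omega⟩

theorem colored_singleton (n : ℕ) (e : Elem) (i r : ℕ) :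
    D.colored n (i + e.top + r) [⟨e, i⟩] = D.projectors n i *
      D.shift (n * i) (D.colored n e.top [⟨e, 0⟩]) *
        D.shift (n * (i + e.bot)) (D.projectors n r) := by
  have h : IsDiag [⟨e, 0⟩] e.top e.bot := by simpa using isDiag_singleton e 0 0
  have h2 := h.addLeft i
  have := D.colored_right n r h2
  rw [D.colored_shift n i h] at this
  simpa [Slice.shift] using this

/-- The bare statement is the interchange law `Hom.comm`. The rest of the proof lets both pieces
absorb the projectors of the idle levels: `y` is the right piece together with the `d` strands
between. -/
theorem colored_far (n : ℕ) (e e' : Elem) (d : ℕ) :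
    D.colored n (e.top + d + e'.top) [⟨e, 0⟩, ⟨e', e.bot + d⟩] =
      D.colored n (e.top + d + e'.top) [⟨e', e.top + d⟩, ⟨e, 0⟩] := by
  have h : IsDiag [⟨e, 0⟩] e.top e.bot := by simpa using isDiag_singleton e 0 0
  have hw := D.hom_colored n h
  have h1 : IsDiag [⟨e, 0⟩] (e.top + d + e'.top) (e.bot + d + e'.top) := by
    simpa [Nat.add_assoc] using isDiag_singleton e 0 (d + e'.top)
  have h2 : IsDiag [⟨e', e.top + d⟩] (e.top + d + e'.top) (e.top + d + e'.bot) :=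
    isDiag_singleton e' (e.top + d) 0
  have e1 := D.colored_singleton n e 0 (d + e'.top)
  have e2 := D.colored_singleton n e' (e.bot + d) 0
  have e3 := D.colored_singleton n e' (e.top + d) 0
  have e4 := D.colored_singleton n e 0 (d + e'.bot)
  have hp : D.projectors n 0 = 1 := rfl
  have hL := D.projectors_mul_colored n e.top [⟨e, 0⟩]
  have hR := D.colored_mul_projectors n h
  have hL' := D.projectors_mul_colored n e'.top [⟨e', 0⟩]
  have hR' := D.colored_mul_projectors n (show IsDiag [⟨e', 0⟩] e'.top e'.bot by
    simpa using isDiag_singleton e' 0 0)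
  simp only [Nat.zero_add, Nat.add_zero, mul_zero, D.shift_zero, hp, one_mul, mul_one, map_one,
    ← Nat.add_assoc] at e1 e2 e3 e4
  rw [show [(⟨e, 0⟩ : Slice), ⟨e', e.bot + d⟩] = [⟨e, 0⟩] ++ [⟨e', e.bot + d⟩] from rfl,
    show [(⟨e', e.top + d⟩ : Slice), ⟨e, 0⟩] = [⟨e', e.top + d⟩] ++ [⟨e, 0⟩] from rfl,
    D.colored_append n _ h1, D.colored_append n _ h2, e1, e2, e3, e4]
  set w := D.colored n e.top [⟨e, 0⟩]
  set w' := D.colored n e'.top [⟨e', 0⟩]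
  set y := D.projectors n d * D.shift (n * d) w' with hy
  have ht : D.projectors n (e.top + d) * D.shift (n * (e.top + d)) w' =
      D.projectors n e.top * D.shift (n * e.top) y := by
    rw [projectors_add, hy, map_mul, D.shift_shift, mul_add, mul_assoc]
  have hb : D.projectors n (e.bot + d) * D.shift (n * (e.bot + d)) w' =
      D.projectors n e.bot * D.shift (n * e.bot) y := by
    rw [projectors_add, hy, map_mul, D.shift_shift, mul_add, mul_assoc]
  have hc' := (D.hom_projectors n d).comm
  have hy1 : D.projectors n (d + e'.top) * y = y := by
    rw [projectors_add, hy, hc', mul_assoc, ← mul_assoc (D.projectors n d), projectors_mul_self, hc',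
      ← mul_assoc, ← map_mul, hL']
  have hy2 : y * D.projectors n (d + e'.bot) = y := by
    rw [projectors_add, hy, hc', mul_assoc, ← mul_assoc (D.projectors n d), projectors_mul_self, hc',
      ← mul_assoc, ← map_mul, hR']
  rw [hb, ht]
  clear_value y
  calc _ = w * (D.shift (n * e.bot) (D.projectors n (d + e'.top)) * D.projectors n e.bot) *
        D.shift (n * e.bot) y := by simp only [mul_assoc]
    _ = w * D.projectors n e.bot * D.shift (n * e.bot) (D.projectors n (d + e'.top) * y) := by
      rw [← (D.hom_projectors n e.bot).comm, map_mul]; simp only [mul_assoc]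
    _ = w * D.shift (n * e.bot) (y * D.projectors n (d + e'.bot)) := by rw [hR, hy1, hy2]
    _ = D.projectors n e.top * (w * D.shift (n * e.bot) y) *
        D.shift (n * e.bot) (D.projectors n (d + e'.bot)) := by
      rw [← mul_assoc (D.projectors n _), hL, map_mul, mul_assoc]
    _ = _ := by rw [hw.comm]; simp only [mul_assoc]

end PlanarCalculus

/-! ### Invariance of colored words under moves inside a diagram -/

theorem IsDiag.split {u v : List Slice} {k m : ℕ} (h : IsDiag (u ++ v) k m) :
    ∃ l, IsDiag u k l ∧ IsDiag v l m := by
  induction u generalizing k with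
  | nil => exact ⟨k, rfl, h⟩
  | cons s u ih =>
    obtain ⟨l, h1, h2⟩ := ih h.2
    exact ⟨l, ⟨h.1, h1⟩, h2⟩

theorem IsDiag.right_unique {w : List Slice} {k l l' : ℕ} (h : IsDiag w k l)
    (h' : IsDiag w k l') : l = l' := by
  induction w generalizing k with
  | nil => exact Eq.trans (Eq.symm h) h'
  | cons s w ih => exact ih h.2 h'.2

theorem IsDiag.left_unique {w : List Slice} {k k' l : ℕ} (h : IsDiag w k l)
    (h' : IsDiag w k' l) : k = k' := by
  induction w generalizing k k' with
  | nil => exact Eq.trans h (Eq.symm h')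
  | cons s w ih =>
    have h1 := h.1
    have h1' := h'.1
    have := ih h.2 h'.2
    omega

namespace PlanarCalculus

variable {B : Type*} [Ring B] [Algebra K B] (D : PlanarCalculus B)

theorem colored_shift_of_le {n k₀ l₀ : ℕ} {u v : List Slice} {c : K} (hu : IsDiag u k₀ l₀)
    (hv : IsDiag v k₀ l₀) (h : D.colored n k₀ u = c • D.colored n k₀ v) {i k : ℕ}
    (hk : i + k₀ ≤ k) :
    D.colored n k (u.map (Slice.shift i)) = c • D.colored n k (v.map (Slice.shift i)) := by
  obtain ⟨r, rfl⟩ := Nat.exists_eq_add_of_le hk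
  exact D.colored_shift_right hu hv h i r

/-- Each move is checked at position `0` in the smallest window that holds it. That the window fits
is read off from `u`; the word `v` may be empty and would give no bound. -/
theorem colored_regularMove {u v : List Slice} (h : RegularMove u v) (n : ℕ) {k l : ℕ}
    (hu : IsDiag u k l) : D.colored n k u = D.colored n k v := by
  suffices H : D.colored n k u = (1 : K) • D.colored n k v by rwa [one_smul] at H
  cases h with
  | far e e' i d =>
    have h1 : IsDiag [⟨e, 0⟩, ⟨e', e.bot + d⟩] (e.top + d + e'.top) (e.bot + d + e'.bot) := by
      simp only [IsDiag]; omega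
    have h2 : IsDiag [⟨e', e.top + d⟩, ⟨e, 0⟩] (e.top + d + e'.top) (e.bot + d + e'.bot) := by
      simp only [IsDiag]; omega
    have hk : i + (e.top + d + e'.top) ≤ k := by
      simp only [IsDiag] at hu; omega
    have := D.colored_shift_of_le (n := n) (c := 1) h1 h2 (by rw [one_smul, D.colored_far]) hk
    simpa [Slice.shift, Nat.add_assoc] using this
  | zigzag_right i =>
    exact D.colored_shift_of_le (c := 1) (u := [TangleSkein.cap 1, TangleSkein.cup 0]) (v := []) (k₀ := 1) (l₀ := 1)
      (by simp [IsDiag, Elem.top, Elem.bot]) rfl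
      (by rw [one_smul, D.colored_zigzag_right]) (by simpa [Elem.top] using hu.1)
  | zigzag_left i =>
    exact D.colored_shift_of_le (c := 1) (u := [TangleSkein.cap 0, TangleSkein.cup 1]) (v := []) (k₀ := 1) (l₀ := 1)
      (by simp [IsDiag, Elem.top, Elem.bot]) rfl
      (by rw [one_smul, D.colored_zigzag_left])
      (by simp only [IsDiag, Elem.top, Elem.bot] at hu; omega)
  | slide_cap b i =>
    exact D.colored_shift_of_le (c := 1) (u := [TangleSkein.cap 1, TangleSkein.cross b 0]) (v := [TangleSkein.cap 0, TangleSkein.cross (!b) 1])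
      (k₀ := 1) (l₀ := 3)
      (by simp [IsDiag, Elem.top, Elem.bot]) (by simp [IsDiag, Elem.top, Elem.bot])
      (by rw [one_smul, D.colored_slide_cap]) (by simpa [Elem.top] using hu.1)
  | slide_cup b i =>
    exact D.colored_shift_of_le (c := 1) (u := [TangleSkein.cross b 0, TangleSkein.cup 1]) (v := [TangleSkein.cross (!b) 1, TangleSkein.cup 0])
      (k₀ := 3) (l₀ := 1)
      (by simp [IsDiag, Elem.top, Elem.bot]) (by simp [IsDiag, Elem.top, Elem.bot])
      (by rw [one_smul, D.colored_slide_cup])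
      (by simp only [IsDiag, Elem.top, Elem.bot] at hu; omega)
  | reidemeister_two b i =>
    exact D.colored_shift_of_le (c := 1) (u := [TangleSkein.cross b 0, TangleSkein.cross (!b) 0]) (v := []) (k₀ := 2) (l₀ := 2)
      (by simp [IsDiag, Elem.top, Elem.bot]) rfl
      (by rw [one_smul, D.colored_reidemeister_two]) (by simpa [Elem.top] using hu.1)
  | reidemeister_three b i =>
    exact D.colored_shift_of_le (c := 1) (u := [TangleSkein.cross b 0, TangleSkein.cross b 1, TangleSkein.cross b 0])
      (v := [TangleSkein.cross b 1, TangleSkein.cross b 0, TangleSkein.cross b 1]) (k₀ := 3) (l₀ := 3)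
      (by simp [IsDiag, Elem.top, Elem.bot]) (by simp [IsDiag, Elem.top, Elem.bot])
      (by rw [one_smul, D.colored_reidemeister_three])
      (by simp only [IsDiag, Elem.top, Elem.bot] at hu; omega)

theorem colored_ambientMove {u v : List Slice} (h : AmbientMove u v) (n : ℕ) {k l : ℕ}
    (hu : IsDiag u k l) : ∃ c : K, c ≠ 0 ∧ D.colored n k u = c • D.colored n k v := by
  cases h with
  | regular h => exact ⟨1, one_ne_zero, by rw [one_smul, D.colored_regularMove h n hu]⟩
  | reidemeister_one_right b i =>
    obtain ⟨c, hc, h⟩ := D.exists_jonesWenzl_mul_curlRight b n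
    refine ⟨c, hc, D.colored_shift_of_le (u := TangleSkein.curlRight b 0) (v := []) (k₀ := 1)
      (l₀ := 1) (by simp [TangleSkein.curlRight, IsDiag, Elem.top, Elem.bot]) rfl ?_
      (by simpa [Elem.top] using hu.1)⟩
    rw [colored_curlRight, h, smul_mul_assoc, jonesWenzl_mul_self, colored, projectors_one]
  | reidemeister_one_left b i =>
    obtain ⟨c, hc, h⟩ := D.exists_jonesWenzl_mul_curlLeft b n
    refine ⟨c, hc, D.colored_shift_of_le (u := TangleSkein.curlLeft b 0) (v := []) (k₀ := 1)
      (l₀ := 1) (by simp [TangleSkein.curlLeft, IsDiag, Elem.top, Elem.bot]) rfl ?_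
      (by simp only [TangleSkein.curlLeft, IsDiag, Elem.top, Elem.bot] at hu; omega)⟩
    rw [colored_curlLeft, h, smul_mul_assoc, jonesWenzl_mul_self, colored, projectors_one]

/-- Ambient isotopic tangles have proportional colored diagrams. -/
theorem exists_colored_eq_smul (n : ℕ) {k l : ℕ} {T T' : Diag k l} (h : AmbientIsotopic T T') :
    ∃ c : K, c ≠ 0 ∧ D.colored n k T.1 = c • D.colored n k T'.1 := by
  induction h with
  | rel T T' h =>
    obtain ⟨p, u, v, q, hm, h1, h2⟩ := h
    have hT := T.2
    have hT' := T'.2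
    rw [h1] at hT ⊢
    rw [h2] at hT' ⊢
    obtain ⟨b, hpu, hq⟩ := hT.split
    obtain ⟨a, hp, hu⟩ := hpu.split
    obtain ⟨b', hpv, hq'⟩ := hT'.split
    obtain ⟨a', hp', hv⟩ := hpv.split
    -- The part above the move fixes the width at its top and the part below fixes the width at its
    -- bottom, so both sides of the move have the same end points.
    obtain rfl := hp.right_unique hp'
    obtain rfl := hq.left_unique hq'
    obtain ⟨c, hc, h⟩ := D.colored_ambientMove hm n hu
    refine ⟨c, hc, ?_⟩
    rw [D.colored_append n q hpu, D.colored_append n q hpv, D.colored_append n u hp,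
      D.colored_append n v hp, h]
    simp
  | refl T => exact ⟨1, one_ne_zero, (one_smul _ _).symm⟩
  | symm T T' _ ih =>
    obtain ⟨c, hc, h⟩ := ih
    exact ⟨c⁻¹, inv_ne_zero hc, by rw [h, smul_smul, inv_mul_cancel₀ hc, one_smul]⟩
  | trans T T' T'' _ _ ih ih' =>
    obtain ⟨c, hc, h⟩ := ih
    obtain ⟨c', hc', h'⟩ := ih'
    exact ⟨c * c', mul_ne_zero hc hc', by rw [h, h', smul_smul]⟩

end PlanarCalculus

/-! ### Skein modules of strips of unspecified width -/

theorem IsDiag.of_addLeft {w : List Slice} {a k l : ℕ}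
    (h : IsDiag (w.map (Slice.shift a)) (a + k) (a + l)) : IsDiag w k l := by
  induction w generalizing k with
  | nil => simp only [IsDiag, List.map_nil] at h ⊢; omega
  | cons s w ih =>
    obtain ⟨h1, h2⟩ := h
    simp only [Slice.shift] at h1 h2
    refine ⟨by omega, ih ?_⟩
    rwa [show a + k - s.elem.top + s.elem.bot = a + (k - s.elem.top + s.elem.bot) by omega] at h2

theorem exists_isDiag (w : List Slice) : ∃ k l, IsDiag w k l := by
  induction w with
  | nil => exact ⟨0, 0, rfl⟩
  | cons s w ih =>
    obtain ⟨k, l, h⟩ := ih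
    refine ⟨s.pos + s.elem.top + k, l + (s.pos + s.elem.bot), by omega, ?_⟩
    have := h.addRight (s.pos + s.elem.bot)
    rwa [show s.pos + s.elem.top + k - s.elem.top + s.elem.bot = k + (s.pos + s.elem.bot) by omega]

theorem Skein.sub_eq_zero_of_rel {k l : ℕ} {x : Formal k l} (h : SkeinRel x) :
    (skeinRelations k l).mkQ x = 0 :=
  (Submodule.Quotient.mk_eq_zero _).2 (Submodule.subset_span h)

theorem Skein.of_eq_of_step {k l : ℕ} {d d' : Diag k l} (h : Step FramedMove d d') :
    Skein.of d = Skein.of d' := by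
  have := Skein.sub_eq_zero_of_rel (.isotopy d d' h)
  rwa [map_sub, sub_eq_zero] at this

theorem Skein.of_cross_true {k l : ℕ} {d dh dv : Diag k l} {p q : List Slice} {i : ℕ}
    (h : d.1 = p ++ [cross true i] ++ q) (hh : dh.1 = p ++ [cup i, cap i] ++ q)
    (hv : dv.1 = p ++ [] ++ q) : Skein.of d = A • Skein.of dh + A⁻¹ • Skein.of dv := by
  have := Skein.sub_eq_zero_of_rel (.cross_true d dh dv p q i h hh hv)
  rwa [map_sub, map_sub, map_smul, map_smul, sub_sub, sub_eq_zero] at this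

theorem Skein.of_cross_false {k l : ℕ} {d dh dv : Diag k l} {p q : List Slice} {i : ℕ}
    (h : d.1 = p ++ [cross false i] ++ q) (hh : dh.1 = p ++ [cup i, cap i] ++ q)
    (hv : dv.1 = p ++ [] ++ q) : Skein.of d = A • Skein.of dv + A⁻¹ • Skein.of dh := by
  have := Skein.sub_eq_zero_of_rel (.cross_false d dh dv p q i h hh hv)
  rwa [map_sub, map_sub, map_smul, map_smul, sub_sub, sub_eq_zero] at this

theorem Skein.of_circle {k l : ℕ} {d d' : Diag k l} {p q : List Slice} {i : ℕ}
    (h : d.1 = p ++ [cap i, cup i] ++ q) (h' : d'.1 = p ++ [] ++ q) :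
    Skein.of d = loopValue • Skein.of d' := by
  have := Skein.sub_eq_zero_of_rel (.circle d d' p q i h h')
  rwa [map_sub, map_smul, sub_eq_zero] at this

theorem Skein.induced_of {k l k' l' : ℕ} (a : ℕ) (p₀ q₀ : List Slice)
    (φ : Diag k l → Diag k' l') (hφ : ∀ d, (φ d).1 = p₀ ++ d.1.map (Slice.shift a) ++ q₀)
    (d : Diag k l) : Skein.induced a p₀ q₀ φ hφ (Skein.of d) = Skein.of (φ d) := by
  exact congrArg (skeinRelations k' l').mkQ Finsupp.mapDomain_single

/-- The diagram with given slices. -/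
def Diag.ofWord {k l : ℕ} (w : List Slice) (h : IsDiag w k l) : Diag k l := ⟨w, h⟩

/-- Formal linear combinations of words of slices. -/
abbrev WordAlgebra : Type := MonoidAlgebra K (FreeMonoid Slice)

/-- A word of slices as an element of the algebra of words. -/
noncomputable def word (w : List Slice) : WordAlgebra :=
  MonoidAlgebra.of K (FreeMonoid Slice) (FreeMonoid.ofList w)

theorem word_append (u v : List Slice) : word (u ++ v) = word u * word v :=
  map_mul (MonoidAlgebra.of K (FreeMonoid Slice)) _ _

theorem word_nil : word [] = 1 := map_one (MonoidAlgebra.of K (FreeMonoid Slice))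

theorem WordAlgebra.induction {P : WordAlgebra → Prop} (x : WordAlgebra)
    (add : ∀ x y, P x → P y → P (x + y)) (smul_word : ∀ (c : K) w, P (c • word w)) : P x := by
  induction x using MonoidAlgebra.induction_linear with
  | zero => simpa using smul_word 0 []
  | add x y hx hy => exact add x y hx hy
  | single w c =>
    have := smul_word c w.toList
    rwa [word, FreeMonoid.ofList_toList, MonoidAlgebra.smul_of] at this

/-- Add `a` strands on the left of all words. -/
noncomputable def WordAlgebra.shift (a : ℕ) : WordAlgebra →ₐ[K] WordAlgebra :=
  MonoidAlgebra.mapDomainAlgHom K K (FreeMonoid.map (Slice.shift a))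

theorem WordAlgebra.shift_word (a : ℕ) (w : List Slice) :
    WordAlgebra.shift a (word w) = word (w.map (Slice.shift a)) := by
  simp [WordAlgebra.shift, word, FreeMonoid.ofList_map]

open Classical in
/-- The skein class of the diagram with the given slices between `k` and `l` points; it is zero if
there is no such diagram. -/
noncomputable def wordClass (k l : ℕ) (w : List Slice) : Skein k l :=
  if h : IsDiag w k l then Skein.of (Diag.ofWord w h) else 0

theorem wordClass_of_isDiag {k l : ℕ} {w : List Slice} (h : IsDiag w k l) :
    wordClass k l w = Skein.of (Diag.ofWord w h) := dif_pos h

theorem wordClass_of_not_isDiag {k l : ℕ} {w : List Slice} (h : ¬IsDiag w k l) :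
    wordClass k l w = 0 := dif_neg h

/-- The linear extension of `wordClass`. -/
noncomputable def WordAlgebra.class (k l : ℕ) : WordAlgebra →ₗ[K] Skein k l :=
  Finsupp.linearCombination K (fun w : FreeMonoid Slice => wordClass k l w.toList) ∘ₗ
    (MonoidAlgebra.coeffLinearEquiv K).toLinearMap

theorem WordAlgebra.class_word (k l : ℕ) (w : List Slice) :
    WordAlgebra.class k l (word w) = wordClass k l w := by
  exact (Finsupp.linearCombination_single K _ _).trans (one_smul K _)

/-- A context acts linearly on skein classes even on words that form no diagram of the given widths:
uniqueness of widths shows that such a word forms none inside the context either, so both sides are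
`0`. -/
theorem WordAlgebra.exists_class_context {p q : List Slice} {a k l m m' : ℕ}
    (hp : IsDiag p k (a + m)) (hq : IsDiag q (a + m') l) :
    ∃ G : Skein m m' →ₗ[K] Skein k l, ∀ x,
      WordAlgebra.class k l (word p * WordAlgebra.shift a x * word q) =
        G (WordAlgebra.class m m' x) := by
  obtain ⟨φ, hφ⟩ : ∃ φ : Diag m m' → Diag k l,
      ∀ d, (φ d).1 = p ++ d.1.map (Slice.shift a) ++ q :=
    ⟨fun d => ⟨_, (hp.append (d.2.addLeft a)).append hq⟩, fun d => rfl⟩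
  refine ⟨Skein.induced a p q φ hφ, fun x => ?_⟩
  induction x using WordAlgebra.induction with
  | add x y hx hy => simp only [map_add, mul_add, add_mul, hx, hy]
  | smul_word c w =>
    simp only [map_smul, mul_smul_comm, smul_mul_assoc]
    rw [WordAlgebra.shift_word, ← word_append, ← word_append, WordAlgebra.class_word,
      WordAlgebra.class_word]
    by_cases h : IsDiag w m m'
    · rw [wordClass_of_isDiag h, wordClass_of_isDiag ((hp.append (h.addLeft a)).append hq),
        Skein.induced_of]
      congr 2
      exact Subtype.ext (hφ (Diag.ofWord w h)).symm
    · rw [wordClass_of_not_isDiag h, map_zero, wordClass_of_not_isDiag]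
      intro h'
      obtain ⟨b, h1, h2⟩ := h'.split
      obtain ⟨c, h3, h4⟩ := h1.split
      obtain rfl := h3.right_unique hp
      obtain rfl := h2.left_unique hq
      exact h h4.of_addLeft

open Filter in
/-- Two combinations of words are equivalent if they have the same skein classes as soon as
there are sufficiently many strands on the right. -/
def WordAlgebra.Equiv (x y : WordAlgebra) : Prop :=
  ∀ k l, ∀ᶠ r in atTop, WordAlgebra.class (k + r) (l + r) x = WordAlgebra.class (k + r) (l + r) y

namespace WordAlgebra

theorem Equiv.context {x y : WordAlgebra} (h : Equiv x y) (a : ℕ) (p q : List Slice) :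
    Equiv (word p * shift a x * word q) (word p * shift a y * word q) := by
  intro k l
  obtain ⟨b, c, hp⟩ := exists_isDiag p
  obtain ⟨b', c', hq⟩ := exists_isDiag q
  obtain ⟨R, hR⟩ := Filter.eventually_atTop.1 (h (c + k + c') (b' + l + b))
  -- Here `p` leads from `b` to `c` strands and `q` from `b'` to `c'`. The base widths `c + k + c'`
  -- and `b' + l + b` are chosen so that padding `p` and `q` leaves the same surplus `R + t` at both
  -- inner levels.
  refine Filter.eventually_atTop.2 ⟨R + (b + c' + a), fun r hr => ?_⟩
  obtain ⟨t, rfl⟩ := Nat.exists_eq_add_of_le hr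
  have hR := hR (R + t) (by omega)
  have hp' := hp.addRight (k + (R + t) + c' + a)
  have hq' := hq.addRight (l + (R + t) + b + a)
  rw [show b + (k + (R + t) + c' + a) = k + (R + (b + c' + a) + t) by ring,
    show c + (k + (R + t) + c' + a) = a + (c + k + c' + (R + t)) by ring] at hp'
  rw [show c' + (l + (R + t) + b + a) = l + (R + (b + c' + a) + t) by ring,
    show b' + (l + (R + t) + b + a) = a + (b' + l + b + (R + t)) by ring] at hq'
  obtain ⟨G, hG⟩ := exists_class_context hp' hq'
  rw [hG, hG, hR]

theorem Equiv.refl (x : WordAlgebra) : Equiv x x := fun _ _ => .of_forall fun _ => rfl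

theorem Equiv.symm {x y : WordAlgebra} (h : Equiv x y) : Equiv y x := fun k l =>
  (h k l).mono fun _ hr => hr.symm

theorem Equiv.trans {x y z : WordAlgebra} (h : Equiv x y) (h' : Equiv y z) : Equiv x z :=
  fun k l => ((h k l).and (h' k l)).mono fun _ hr => hr.1.trans hr.2

theorem Equiv.add {x y x' y' : WordAlgebra} (h : Equiv x y) (h' : Equiv x' y') :
    Equiv (x + x') (y + y') := fun k l =>
  ((h k l).and (h' k l)).mono fun _ hr => by rw [map_add, map_add, hr.1, hr.2]

theorem Equiv.smul {x y : WordAlgebra} (c : K) (h : Equiv x y) : Equiv (c • x) (c • y) :=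
  fun k l => (h k l).mono fun _ hr => by rw [map_smul, map_smul, hr]

theorem shift_zero (x : WordAlgebra) : shift 0 x = x := by
  induction x using WordAlgebra.induction with
  | add x y hx hy => rw [map_add, hx, hy]
  | smul_word c w => rw [map_smul, shift_word, Slice.shift_zero, List.map_id]

theorem shift_shift (a b : ℕ) (x : WordAlgebra) : shift a (shift b x) = shift (a + b) x := by
  induction x using WordAlgebra.induction with
  | add x y hx hy => simp only [map_add, hx, hy]
  | smul_word c w =>
    simp only [map_smul, shift_word, List.map_map]
    congr 2
    apply List.map_congr_left
    intro s _
    simp [Slice.shift, Nat.add_assoc]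

theorem Equiv.shift {x y : WordAlgebra} (h : Equiv x y) (a : ℕ) :
    Equiv (shift a x) (WordAlgebra.shift a y) := by
  simpa [word_nil] using h.context a [] []

theorem Equiv.mul_right {x y : WordAlgebra} (h : Equiv x y) (z : WordAlgebra) :
    Equiv (x * z) (y * z) := by
  induction z using WordAlgebra.induction with
  | add z z' hz hz' => rw [mul_add, mul_add]; exact hz.add hz'
  | smul_word c w =>
    rw [mul_smul_comm, mul_smul_comm]
    have := h.context 0 [] w
    rw [word_nil, one_mul, one_mul, shift_zero, shift_zero] at this
    exact this.smul c

theorem Equiv.mul_left {x y : WordAlgebra} (h : Equiv x y) (z : WordAlgebra) :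
    Equiv (z * x) (z * y) := by
  induction z using WordAlgebra.induction with
  | add z z' hz hz' => rw [add_mul, add_mul]; exact hz.add hz'
  | smul_word c w =>
    rw [smul_mul_assoc, smul_mul_assoc]
    have := h.context 0 w []
    rw [word_nil, mul_one, mul_one, shift_zero, shift_zero] at this
    exact this.smul c

/-- Equivalence of combinations of words, as a congruence relation. -/
def con : RingCon WordAlgebra where
  r := Equiv
  iseqv := ⟨Equiv.refl, Equiv.symm, Equiv.trans⟩
  add' := Equiv.add
  mul' h h' := (h.mul_right _).trans (h'.mul_left _)

end WordAlgebra

/-- Skein classes of tangles in a strip with sufficiently many strands on the right. -/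
abbrev StripAlgebra : Type := WordAlgebra.con.Quotient

namespace StripAlgebra

/-- The class of a word. -/
noncomputable def of (w : List Slice) : StripAlgebra := WordAlgebra.con.mkₐ K (word w)

theorem of_append (u v : List Slice) : of (u ++ v) = of u * of v := by
  rw [of, word_append, map_mul]; rfl

theorem of_nil : of [] = 1 := by rw [of, word_nil, map_one]

theorem mk_eq_of_equiv {x y : WordAlgebra} (h : WordAlgebra.Equiv x y) :
    WordAlgebra.con.mkₐ K x = WordAlgebra.con.mkₐ K y :=
  Quotient.sound h

/-- Add `a` strands on the left. -/
noncomputable def shift (a : ℕ) : StripAlgebra →ₐ[K] StripAlgebra :=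
  WordAlgebra.con.liftₐ ((WordAlgebra.con.mkₐ K).comp (WordAlgebra.shift a))
    fun _ _ h => mk_eq_of_equiv (WordAlgebra.Equiv.shift h a)

theorem shift_mk (a : ℕ) (x : WordAlgebra) :
    shift a (WordAlgebra.con.mkₐ K x) = WordAlgebra.con.mkₐ K (WordAlgebra.shift a x) := rfl

theorem shift_of (a : ℕ) (w : List Slice) : shift a (of w) = of (w.map (Slice.shift a)) := by
  rw [of, shift_mk, WordAlgebra.shift_word, of]

theorem induction {P : StripAlgebra → Prop} (x : StripAlgebra)
    (add : ∀ x y, P x → P y → P (x + y)) (smul : ∀ (c : K) x, P x → P (c • x))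
    (one : P 1) (mul : ∀ s x, P x → P (of [s] * x)) : P x := by
  obtain ⟨x, rfl⟩ := RingCon.mkₐ_surjective (α := K) WordAlgebra.con x
  induction x using WordAlgebra.induction with
  | add x y hx hy => rw [map_add]; exact add _ _ hx hy
  | smul_word c w =>
    rw [map_smul]
    apply smul
    change P (of w)
    induction w with
    | nil => rwa [of_nil]
    | cons s w ih =>
      rw [← List.singleton_append, of_append]
      exact mul _ _ ih

end StripAlgebra

/-! ### The relations of the skein module in the strip algebra -/

/-- The two sides of a move may require different minimal widths, as a zigzag and the empty word do.
This is why words are compared only after adding many strands. -/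
theorem FramedMove.isDiag_iff {u v : List Slice} (h : FramedMove u v) :
    ∃ R, ∀ k ≥ R, ∀ l, IsDiag u k l ↔ IsDiag v k l := by
  cases h with
  | regular h =>
    cases h with
    | far e e' i d =>
      refine ⟨i + e.top + d + e'.top, fun k hk l => ?_⟩
      simp only [IsDiag]; omega
    | zigzag_right i =>
      refine ⟨i + 5, fun k hk l => ?_⟩
      simp only [IsDiag, Elem.top, Elem.bot]; omega
    | zigzag_left i =>
      refine ⟨i + 5, fun k hk l => ?_⟩
      simp only [IsDiag, Elem.top, Elem.bot]; omega
    | slide_cap b i =>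
      refine ⟨i + 5, fun k hk l => ?_⟩
      simp only [IsDiag, Elem.top, Elem.bot]; omega
    | slide_cup b i =>
      refine ⟨i + 5, fun k hk l => ?_⟩
      simp only [IsDiag, Elem.top, Elem.bot]; omega
    | reidemeister_two b i =>
      refine ⟨i + 5, fun k hk l => ?_⟩
      simp only [IsDiag, Elem.top, Elem.bot]; omega
    | reidemeister_three b i =>
      refine ⟨i + 5, fun k hk l => ?_⟩
      simp only [IsDiag, Elem.top, Elem.bot]; omega
  | curl b i =>
    refine ⟨i + 5, fun k hk l => ?_⟩
    simp only [curlRight, curlLeft, IsDiag, Elem.top, Elem.bot]; omega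

namespace StripAlgebra

theorem of_eq_of_framedMove {u v : List Slice} (h : FramedMove u v) : of u = of v := by
  refine mk_eq_of_equiv fun k l => ?_
  obtain ⟨R, hR⟩ := h.isDiag_iff
  refine Filter.eventually_atTop.2 ⟨R, fun r hr => ?_⟩
  have hiff := hR (k + r) (by omega) (l + r)
  rw [WordAlgebra.class_word, WordAlgebra.class_word]
  by_cases hu : IsDiag u (k + r) (l + r)
  · rw [wordClass_of_isDiag hu, wordClass_of_isDiag (hiff.1 hu)]
    exact Skein.of_eq_of_step ⟨[], u, v, [], h, by simp [Diag.ofWord], by simp [Diag.ofWord]⟩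
  · rw [wordClass_of_not_isDiag hu, wordClass_of_not_isDiag (mt hiff.2 hu)]

theorem of_cross_true (i : ℕ) : of [cross true i] = A • of [cup i, cap i] + A⁻¹ • 1 := by
  rw [← of_nil]
  simp only [of]
  rw [← map_smul, ← map_smul, ← map_add]
  refine mk_eq_of_equiv fun k l => Filter.eventually_atTop.2 ⟨i + 2, fun r hr => ?_⟩
  simp only [map_add, map_smul, WordAlgebra.class_word]
  by_cases hkl : k = l
  · subst hkl
    have h1 : IsDiag [cross true i] (k + r) (k + r) := by
      simp only [IsDiag, Elem.top, Elem.bot]; omega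
    have h2 : IsDiag [cup i, cap i] (k + r) (k + r) := by
      simp only [IsDiag, Elem.top, Elem.bot]; omega
    have h3 : IsDiag [] (k + r) (k + r) := rfl
    rw [wordClass_of_isDiag h1, wordClass_of_isDiag h2, wordClass_of_isDiag h3]
    exact Skein.of_cross_true (p := []) (q := []) (i := i) rfl rfl rfl
  · rw [wordClass_of_not_isDiag, wordClass_of_not_isDiag, wordClass_of_not_isDiag, smul_zero,
      smul_zero, add_zero] <;> simp only [IsDiag, Elem.top, Elem.bot] <;> omega

theorem of_cross_false (i : ℕ) : of [cross false i] = A • 1 + A⁻¹ • of [cup i, cap i] := by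
  rw [← of_nil]
  simp only [of]
  rw [← map_smul, ← map_smul, ← map_add]
  refine mk_eq_of_equiv fun k l => Filter.eventually_atTop.2 ⟨i + 2, fun r hr => ?_⟩
  simp only [map_add, map_smul, WordAlgebra.class_word]
  by_cases hkl : k = l
  · subst hkl
    have h1 : IsDiag [cross false i] (k + r) (k + r) := by
      simp only [IsDiag, Elem.top, Elem.bot]; omega
    have h2 : IsDiag [cup i, cap i] (k + r) (k + r) := by
      simp only [IsDiag, Elem.top, Elem.bot]; omega
    have h3 : IsDiag [] (k + r) (k + r) := rfl
    rw [wordClass_of_isDiag h1, wordClass_of_isDiag h2, wordClass_of_isDiag h3]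
    exact Skein.of_cross_false (p := []) (q := []) (i := i) rfl rfl rfl
  · rw [wordClass_of_not_isDiag, wordClass_of_not_isDiag, wordClass_of_not_isDiag, smul_zero,
      smul_zero, add_zero] <;> simp only [IsDiag, Elem.top, Elem.bot] <;> omega

theorem of_circle (i : ℕ) : of [cap i, cup i] = loopValue • 1 := by
  rw [← of_nil]
  simp only [of]
  rw [← map_smul]
  refine mk_eq_of_equiv fun k l => Filter.eventually_atTop.2 ⟨i, fun r hr => ?_⟩
  simp only [map_smul, WordAlgebra.class_word]
  by_cases hkl : k = l
  · subst hkl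
    have h1 : IsDiag [cap i, cup i] (k + r) (k + r) := by
      simp only [IsDiag, Elem.top, Elem.bot]; omega
    have h3 : IsDiag [] (k + r) (k + r) := rfl
    rw [wordClass_of_isDiag h1, wordClass_of_isDiag h3]
    exact Skein.of_circle (p := []) (q := []) (i := i) rfl rfl
  · rw [wordClass_of_not_isDiag, wordClass_of_not_isDiag, smul_zero] <;>
      simp only [IsDiag, Elem.top, Elem.bot] <;> omega

/-- Caps and cups in the algebra of tangles in a strip. -/
noncomputable def planarCalculus : PlanarCalculus StripAlgebra where
  cap i := of [cap i]
  cup i := of [cup i]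
  shift := shift
  shift_zero x := by
    obtain ⟨x, rfl⟩ := RingCon.mkₐ_surjective (α := K) WordAlgebra.con x
    rw [shift_mk, WordAlgebra.shift_zero]
  shift_shift a b x := by
    obtain ⟨x, rfl⟩ := RingCon.mkₐ_surjective (α := K) WordAlgebra.con x
    rw [shift_mk, shift_mk, shift_mk, WordAlgebra.shift_shift]
  shift_cap a i := shift_of a _
  shift_cup a i := shift_of a _
  cap_far y := by
    induction y using StripAlgebra.induction with
    | add x y hx hy => rw [map_add, mul_add, hx, hy, add_mul]
    | smul c x hx => rw [map_smul, mul_smul_comm, hx, smul_mul_assoc]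
    | one => rw [map_one, mul_one, one_mul]
    | mul s x hx =>
      have := of_eq_of_framedMove (.regular (.far .cap s.elem 0 s.pos))
      simp only [Elem.top, Elem.bot, Nat.zero_add] at this
      rw [map_mul, shift_of, ← mul_assoc, ← of_append, List.map_singleton, List.singleton_append,
        Slice.shift, this, mul_assoc, ← hx, ← mul_assoc, ← of_append, List.singleton_append]
  cup_far y := by
    induction y using StripAlgebra.induction with
    | add x y hx hy => rw [map_add, mul_add, hx, hy, add_mul]
    | smul c x hx => rw [map_smul, mul_smul_comm, hx, smul_mul_assoc]
    | one => rw [map_one, mul_one, one_mul]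
    | mul s x hx =>
      have := of_eq_of_framedMove (.regular (.far .cup s.elem 0 s.pos))
      simp only [Elem.top, Elem.bot, Nat.zero_add] at this
      rw [map_mul, shift_of, mul_assoc, ← hx, ← mul_assoc, ← mul_assoc, ← of_append, ← of_append,
        List.map_singleton, List.singleton_append, List.singleton_append, Slice.shift, ← this]
  cap_one_cup_zero := by
    rw [← of_append, ← of_nil]
    exact of_eq_of_framedMove (.regular (.zigzag_right 0))
  cap_zero_cup_one := by
    rw [← of_append, ← of_nil]
    exact of_eq_of_framedMove (.regular (.zigzag_left 0))
  circle := by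
    rw [← of_append]
    exact of_circle 0

theorem hook_eq (i : ℕ) : planarCalculus.hook i = of [cup i, cap i] := (of_append _ _).symm

theorem cross_eq (b : Bool) (i : ℕ) : planarCalculus.cross b i = of [cross b i] := by
  cases b
  · rw [of_cross_false, ← hook_eq]; rfl
  · rw [of_cross_true, ← hook_eq]; rfl

end StripAlgebra

/-! ### The embedding of the skein modules -/

/-- Removing a strand on the right that is closed up multiplies by the value of a circle. -/
theorem Skein.of_cap_comp {w : List Slice} {k l : ℕ} (h : IsDiag w k l) {a b : ℕ}
    {p q : List Slice} (d d' : Diag a b) (hd : d.1 = p ++ cap k :: w ++ q)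
    (hd' : d'.1 = p ++ w ++ cap l :: q) : Skein.of d = Skein.of d' := by
  induction w generalizing k p d with
  | nil =>
    obtain rfl : k = l := h
    congr 1
    apply Subtype.ext
    rw [hd, hd']
    simp
  | cons s w ih =>
    obtain ⟨r, rfl⟩ := Nat.exists_eq_add_of_le h.1
    have h2 := h.2
    rw [show s.pos + s.elem.top + r - s.elem.top + s.elem.bot = s.pos + s.elem.bot + r by omega]
      at h2
    -- The diagram in which the cap has passed below `s`. Staying at the right edge, the cap changes
    -- its index from the width above `s` to the width below it, and `s` joins the prefix.
    have hw : IsDiag (p ++ [s] ++ cap (s.pos + s.elem.bot + r) :: w ++ q) a b := by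
      have hdiag := d.2
      rw [hd, List.append_assoc] at hdiag
      obtain ⟨m, hp, hm⟩ := hdiag.split
      rw [List.append_assoc, List.append_assoc]
      refine hp.append ?_
      have htop : Elem.cap.top = 0 := rfl
      have hbot : Elem.cap.bot = 2 := rfl
      simp only [List.cons_append, List.nil_append, IsDiag, htop, hbot] at hm ⊢
      obtain ⟨h1, h3, h4⟩ := hm
      refine ⟨by omega, by omega, ?_⟩
      rwa [show m - s.elem.top + s.elem.bot - 0 + 2 = m - 0 + 2 - s.elem.top + s.elem.bot by omega]
    have hstep : Step FramedMove (Diag.ofWord _ hw) d :=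
      ⟨p, [s, cap (s.pos + s.elem.bot + r)], [cap (s.pos + s.elem.top + r), s], w ++ q,
        .regular (.far s.elem .cap s.pos r), by simp [Diag.ofWord], by simp [hd]⟩
    rw [← Skein.of_eq_of_step hstep]
    exact ih h2 (Diag.ofWord _ hw) rfl (by simp [hd'])

theorem Skein.addRight_of {k l : ℕ} (r : ℕ) (d : Diag k l) :
    Skein.addRight r (Skein.of d) = Skein.of (d.addRight r) :=
  Skein.induced_of _ _ _ _ _ _

theorem Skein.addLeft_of {k l : ℕ} (a : ℕ) (d : Diag k l) :
    Skein.addLeft a (Skein.of d) = Skein.of (d.addLeft a) :=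
  Skein.induced_of _ _ _ _ _ _

theorem loopValue_ne_zero : loopValue ≠ 0 := PlanarCalculus.delta_ne_zero 1

/-- Closing up the added strand leaves the original diagram with a separate circle, that is, a left
inverse up to the nonzero factor `δ`. -/
theorem Skein.addRight_one_injective (k l : ℕ) :
    Function.Injective (Skein.addRight 1 : Skein k l →ₗ[K] Skein (k + 1) (l + 1)) := by
  have hcap : IsDiag [cap k] k (k + 2) := by simp [IsDiag, Elem.top, Elem.bot]
  have hcup : IsDiag [cup l] (l + 2) l := by simp [IsDiag, Elem.top, Elem.bot]
  obtain ⟨φ, hφ⟩ : ∃ φ : Diag (k + 1) (l + 1) → Diag k l,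
      ∀ d, (φ d).1 = [cap k] ++ d.1.map (Slice.shift 0) ++ [cup l] :=
    ⟨fun d => Diag.ofWord _
      ((hcap.append (by simpa [Slice.shift_zero] using d.2.addRight 1)).append hcup), fun d => rfl⟩
  have key : (Skein.induced 0 [cap k] [cup l] φ hφ) ∘ₗ (Skein.addRight 1) =
      loopValue • (LinearMap.id : Skein k l →ₗ[K] Skein k l) := by
    apply Skein.hom_ext
    intro d
    rw [LinearMap.comp_apply, Skein.addRight_of, Skein.induced_of, LinearMap.smul_apply,
      LinearMap.id_apply]
    have hw : IsDiag (d.1 ++ [cap l, cup l]) k l :=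
      d.2.append (by simp [IsDiag, Elem.top, Elem.bot])
    rw [Skein.of_cap_comp (p := []) (q := [cup l]) d.2 (φ (d.addRight 1)) (Diag.ofWord _ hw)
      (by rw [hφ, Slice.shift_zero, List.map_id]; rfl) (by simp [Diag.ofWord])]
    exact Skein.of_circle (p := d.1) (q := []) (i := l) (by simp [Diag.ofWord]) (by simp)
  intro x y hxy
  have := congrArg (Skein.induced 0 [cap k] [cup l] φ hφ) hxy
  rw [← LinearMap.comp_apply, ← LinearMap.comp_apply, key] at this
  exact smul_right_injective _ loopValue_ne_zero this

theorem Skein.addRight_injective (k l r : ℕ) :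
    Function.Injective (Skein.addRight r : Skein k l →ₗ[K] Skein (k + r) (l + r)) := by
  induction r with
  | zero =>
    have : (Skein.addRight 0 : Skein k l →ₗ[K] Skein (k + 0) (l + 0)) = LinearMap.id := by
      apply Skein.hom_ext
      intro d
      rw [Skein.addRight_of]
      rfl
    rw [this]
    exact fun _ _ h => h
  | succ r ih =>
    have : (Skein.addRight (r + 1) : Skein k l →ₗ[K] Skein (k + (r + 1)) (l + (r + 1))) =
        (Skein.addRight 1 : Skein (k + r) (l + r) →ₗ[K] Skein (k + r + 1) (l + r + 1)) ∘ₗ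
          Skein.addRight r := by
      apply Skein.hom_ext
      intro d
      rw [LinearMap.comp_apply, Skein.addRight_of, Skein.addRight_of, Skein.addRight_of]
      rfl
    rw [this]
    exact (Skein.addRight_one_injective _ _).comp ih

/-- The combination of words underlying a combination of diagrams. -/
noncomputable def Formal.toWord (k l : ℕ) : Formal k l →ₗ[K] WordAlgebra :=
  Finsupp.linearCombination K fun d : Diag k l => word d.1

theorem Formal.toWord_of {k l : ℕ} (d : Diag k l) : Formal.toWord k l (Formal.of d) = word d.1 :=
  (Finsupp.linearCombination_single K _ _).trans (one_smul K _)

theorem Formal.lhom_ext {k l : ℕ} {V : Type*} [AddCommGroup V] [Module K V]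
    {f g : Formal k l →ₗ[K] V} (h : ∀ d, f (Formal.of d) = g (Formal.of d)) : f = g := by
  apply Finsupp.lhom_ext'
  intro d
  apply LinearMap.ext_ring
  exact h d

theorem Formal.class_toWord {k l : ℕ} (r : ℕ) (x : Formal k l) :
    WordAlgebra.class (k + r) (l + r) (Formal.toWord k l x) =
      Skein.addRight r ((skeinRelations k l).mkQ x) := by
  have : (WordAlgebra.class (k + r) (l + r)) ∘ₗ (Formal.toWord k l) =
      (Skein.addRight r) ∘ₗ (skeinRelations k l).mkQ := by
    apply Formal.lhom_ext
    intro d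
    rw [LinearMap.comp_apply, LinearMap.comp_apply, Formal.toWord_of, WordAlgebra.class_word,
      wordClass_of_isDiag (d.2.addRight r)]
    exact (Skein.addRight_of r d).symm
  exact congrArg (fun f => f x) this

theorem StripAlgebra.mk_toWord_eq_zero {k l : ℕ} {x : Formal k l} (hx : SkeinRel x) :
    WordAlgebra.con.mkₐ K (Formal.toWord k l x) = 0 := by
  have hof : ∀ d : Diag k l, WordAlgebra.con.mkₐ K (word d.1) = StripAlgebra.of d.1 := fun _ => rfl
  cases hx with
  | isotopy d d' h =>
    obtain ⟨p, u, v, q, hm, h1, h2⟩ := h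
    simp only [map_sub, Formal.toWord_of, hof]
    rw [h1, h2]
    simp only [StripAlgebra.of_append]
    rw [StripAlgebra.of_eq_of_framedMove hm, sub_self]
  | cross_true d dh dv p q i h1 h2 h3 =>
    simp only [map_sub, map_smul, Formal.toWord_of, hof]
    rw [h1, h2, h3]
    simp only [StripAlgebra.of_append _ q, StripAlgebra.of_append p _]
    rw [StripAlgebra.of_cross_true, StripAlgebra.of_nil, mul_add, add_mul, mul_smul_comm,
      mul_smul_comm, smul_mul_assoc, smul_mul_assoc, sub_sub, sub_self]
  | cross_false d dh dv p q i h1 h2 h3 =>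
    simp only [map_sub, map_smul, Formal.toWord_of, hof]
    rw [h1, h2, h3]
    simp only [StripAlgebra.of_append _ q, StripAlgebra.of_append p _]
    rw [StripAlgebra.of_cross_false, StripAlgebra.of_nil, mul_add, add_mul, mul_smul_comm,
      mul_smul_comm, smul_mul_assoc, smul_mul_assoc, sub_sub, sub_self]
  | circle d d' p q i h1 h2 =>
    simp only [map_sub, map_smul, Formal.toWord_of, hof]
    rw [h1, h2]
    simp only [StripAlgebra.of_append _ q, StripAlgebra.of_append p _]
    rw [StripAlgebra.of_circle, StripAlgebra.of_nil, mul_smul_comm, smul_mul_assoc, sub_self]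

namespace Skein

/-- Skein classes of tangles in the disc, considered in a wide strip. -/
noncomputable def toStrip (k l : ℕ) : Skein k l →ₗ[K] StripAlgebra :=
  Submodule.liftQ (skeinRelations k l)
    ((WordAlgebra.con.mkₐ K).toLinearMap ∘ₗ Formal.toWord k l)
    (Submodule.span_le.2 fun _ hx => StripAlgebra.mk_toWord_eq_zero hx)

theorem toStrip_of {k l : ℕ} (d : Diag k l) : toStrip k l (Skein.of d) = StripAlgebra.of d.1 :=
  congrArg (WordAlgebra.con.mkₐ K) (Formal.toWord_of d)

/-- Vanishing in the strip algebra means vanishing after some number of strands has been added on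
the right, and adding strands is injective. -/
theorem toStrip_injective (k l : ℕ) : Function.Injective (toStrip k l) := by
  rw [injective_iff_map_eq_zero]
  intro x hx
  obtain ⟨x, rfl⟩ := (skeinRelations k l).mkQ_surjective x
  have h : WordAlgebra.Equiv (Formal.toWord k l x) 0 := Quotient.exact hx
  obtain ⟨r, hr⟩ := (h k l).exists
  rw [Formal.class_toWord, map_zero] at hr
  exact Skein.addRight_injective k l r (hr.trans (map_zero _).symm)

theorem toStrip_comp {k l m : ℕ} (x : Skein k l) (y : Skein l m) :
    toStrip k m (Skein.comp x y) = toStrip k l x * toStrip l m y := by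
  have h1 : ∀ d : Diag k l, toStrip k m ∘ₗ Skein.comp (Skein.of d) =
      LinearMap.mulLeft K (toStrip k l (Skein.of d)) ∘ₗ toStrip l m := fun d => by
    apply Skein.hom_ext
    intro d'
    simp only [LinearMap.comp_apply, LinearMap.mulLeft_apply, Skein.comp_of, toStrip_of]
    exact StripAlgebra.of_append _ _
  have h2 : toStrip k m ∘ₗ Skein.comp.flip y =
      LinearMap.mulRight K (toStrip l m y) ∘ₗ toStrip k l := by
    apply Skein.hom_ext
    intro d
    exact congrArg (fun f => f y) (h1 d)
  exact congrArg (fun f => f x) h2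

theorem toStrip_addRight {k l : ℕ} (r : ℕ) (x : Skein k l) :
    toStrip (k + r) (l + r) (Skein.addRight r x) = toStrip k l x := by
  have : toStrip (k + r) (l + r) ∘ₗ Skein.addRight r = toStrip k l := by
    apply Skein.hom_ext
    intro d
    rw [LinearMap.comp_apply, Skein.addRight_of, toStrip_of, toStrip_of]
    rfl
  exact congrArg (fun f => f x) this

theorem toStrip_addLeft {k l : ℕ} (a : ℕ) (x : Skein k l) :
    toStrip (a + k) (a + l) (Skein.addLeft a x) = StripAlgebra.shift a (toStrip k l x) := by
  have : toStrip (a + k) (a + l) ∘ₗ Skein.addLeft a =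
      (StripAlgebra.shift a).toLinearMap ∘ₗ toStrip k l := by
    apply Skein.hom_ext
    intro d
    rw [LinearMap.comp_apply, LinearMap.comp_apply, Skein.addLeft_of, toStrip_of, toStrip_of]
    exact (StripAlgebra.shift_of a d.1).symm
  exact congrArg (fun f => f x) this

end Skein

/-! ### Dictionary between skein elements and the planar calculus -/

open StripAlgebra in
theorem toStrip_jonesWenzl (n : ℕ) :
    Skein.toStrip n n (jonesWenzl n) = planarCalculus.jonesWenzl n := by
  induction n using Nat.twoStepInduction with
  | zero => rw [jonesWenzl, Skein.toStrip_of]; exact of_nil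
  | one => rw [jonesWenzl, Skein.toStrip_of]; exact of_nil
  | more n _ ih =>
    have h : Skein.toStrip (n + 2) (n + 2) (Skein.addRight 1 (jonesWenzl (n + 1))) =
        planarCalculus.jonesWenzl (n + 1) := (Skein.toStrip_addRight 1 _).trans ih
    rw [jonesWenzl, map_sub, map_smul, Skein.toStrip_comp, Skein.toStrip_comp, h,
      Skein.toStrip_of, PlanarCalculus.jonesWenzl, hook_eq]
    rfl

open StripAlgebra in
theorem toStrip_projectors (n k : ℕ) :
    Skein.toStrip (n * k) (n * k) (projectors n k) = planarCalculus.projectors n k := by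
  induction k with
  | zero => rw [projectors, Skein.toStrip_of]; exact of_nil
  | succ k ih =>
    have h1 : Skein.toStrip (n * (k + 1)) (n * (k + 1)) (Skein.addRight n (projectors n k)) =
        planarCalculus.projectors n k := (Skein.toStrip_addRight n _).trans ih
    have h2 : Skein.toStrip (n * (k + 1)) (n * (k + 1)) (Skein.addLeft (n * k) (jonesWenzl n)) =
        planarCalculus.shift (n * k) (planarCalculus.jonesWenzl n) :=
      (Skein.toStrip_addLeft (n * k) _).trans (by rw [toStrip_jonesWenzl]; rfl)
    rw [PlanarCalculus.projectors, ← h1, ← h2]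
    exact Skein.toStrip_comp _ _

namespace StripAlgebra

theorem of_cap_range (a n : ℕ) :
    of ((List.range' a n).map cap) = planarCalculus.shift a (planarCalculus.caps n) := by
  induction n generalizing a with
  | zero => simp [of_nil, PlanarCalculus.caps]
  | succ n ih =>
    rw [List.range'_succ, List.map_cons, ← List.singleton_append, of_append, ih,
      PlanarCalculus.caps, map_mul, planarCalculus.shift_shift, planarCalculus.shift_cap]
    rfl

theorem of_cup_range (a n : ℕ) :
    of ((List.range' a n).reverse.map cup) = planarCalculus.shift a (planarCalculus.cups n) := by
  induction n generalizing a with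
  | zero => simp [of_nil, PlanarCalculus.cups]
  | succ n ih =>
    rw [List.range'_succ, List.reverse_cons, List.map_append, of_append, ih,
      PlanarCalculus.cups, map_mul, planarCalculus.shift_shift, planarCalculus.shift_cup]
    rfl

theorem of_cross_range (b : Bool) (a n : ℕ) :
    of ((List.range' a n).reverse.map (cross b)) =
      planarCalculus.shift a (planarCalculus.crossLeft b n) := by
  induction n generalizing a with
  | zero => simp [of_nil, PlanarCalculus.crossLeft]
  | succ n ih =>
    rw [List.range'_succ, List.reverse_cons, List.map_append, of_append, ih,
      PlanarCalculus.crossLeft_succ, map_mul, planarCalculus.shift_shift,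
      PlanarCalculus.shift_cross, cross_eq]
    rfl

theorem of_cross_grid (b : Bool) (a n q : ℕ) :
    of ((List.range q).flatMap fun j => (List.range' (a + j) n).reverse.map (cross b)) =
      planarCalculus.shift a (planarCalculus.braid b n q) := by
  induction q with
  | zero => simp [of_nil, PlanarCalculus.braid]
  | succ q ih =>
    rw [List.range_succ, List.flatMap_append, of_append, ih, PlanarCalculus.braid, map_mul,
      planarCalculus.shift_shift, ← of_cross_range, List.flatMap_singleton]

theorem of_cable (n : ℕ) (s : Slice) :
    of (s.cable n) = planarCalculus.shift (n * s.pos) (planarCalculus.cable n s.elem) := by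
  obtain ⟨e, i⟩ := s
  cases e with
  | cap => exact of_cap_range _ _
  | cup => exact of_cup_range _ _
  | cross b => exact of_cross_grid b _ _ _

end StripAlgebra

open StripAlgebra

theorem toStrip_cableSkein (n : ℕ) (s : Slice) (k : ℕ) (h : s.pos + s.elem.top ≤ k) :
    Skein.toStrip (n * k) (n * (k - s.elem.top + s.elem.bot)) (s.cableSkein n k h) =
      planarCalculus.shift (n * s.pos) (planarCalculus.cable n s.elem) :=
  (Skein.toStrip_of _).trans (of_cable n s)

theorem toStrip_colorWord (n : ℕ) {k l : ℕ} (w : List Slice) (h : IsDiag w k l) :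
    Skein.toStrip (n * k) (n * l) (colorWord n w k l h) = planarCalculus.colored n k w := by
  induction w generalizing k with
  | nil =>
    obtain rfl : k = l := h
    exact toStrip_projectors n k
  | cons s w ih =>
    rw [colorWord, Skein.toStrip_comp, Skein.toStrip_comp, ih, toStrip_projectors,
      toStrip_cableSkein]
    rfl

/-- Ambient isotopic tangles have proportional colored tangles. -/
theorem exists_coloredTangle_eq_smul (n : ℕ) {k l : ℕ} {T T' : Diag k l}
    (h : AmbientIsotopic T T') :
    ∃ c : K, c ≠ 0 ∧ coloredTangle n T = c • coloredTangle n T' := by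
  obtain ⟨c, hc, h⟩ := planarCalculus.exists_colored_eq_smul n h
  refine ⟨c, hc, Subtype.ext ?_⟩
  have hw : colorWord n T.1 k l T.2 = c • colorWord n T'.1 k l T'.2 := by
    apply Skein.toStrip_injective
    rw [map_smul, toStrip_colorWord, toStrip_colorWord, h]
  change sandwich n k l (colorWord n T.1 k l T.2) =
    c • sandwich n k l (colorWord n T'.1 k l T'.2)
  rw [hw, map_smul]

end TangleSkein

/-- Ambient isotopic `(k, l)`-tangles have the same ratios `γᵢ / γₛ`, `0 ≤ i ≤ s - 1`; in particular these
ratios are defined for one of them if and only if they are defined for the other. -/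
theorem mainTheorem7 (k l n s : ℕ)
    (E : Module.Basis (Fin (s + 1)) TangleSkein.K (TangleSkein.ColoredDisc k l n))
    (T T' : TangleSkein.Diag k l) (hT : TangleSkein.AmbientIsotopic T T') :
    (TangleSkein.gamma E T (Fin.last s) ≠ 0 ↔ TangleSkein.gamma E T' (Fin.last s) ≠ 0) ∧
    ∀ i : Fin s,
      TangleSkein.gamma E T i.castSucc / TangleSkein.gamma E T (Fin.last s) =
        TangleSkein.gamma E T' i.castSucc / TangleSkein.gamma E T' (Fin.last s) := by
  obtain ⟨c, hc, h⟩ := TangleSkein.exists_coloredTangle_eq_smul n hT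
  have hg : ∀ i, TangleSkein.gamma E T i = c * TangleSkein.gamma E T' i := fun i => by
    simp [TangleSkein.gamma, h]
  refine ⟨by simp [hg, hc], fun i => ?_⟩
  -- Only `c ≠ 0` is used: if the last coefficients vanish, both quotients are `0` by the convention
  -- on division by zero.
  rw [hg, hg, mul_div_mul_left _ _ hc]
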